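/- Let $z>y\ge 1$ be integers and let $\alpha,\delta\in[0,1]$. In the $(\alpha,z,y,\delta)$-Balanced Johnson Coverage$^*$ problem the input is $(n,k,E)$ with $n\ge z$, $k\ge 1$ and a collection $E$ of $z$-element subsets of $[n]$ with $|E|=\omega(k\,n^{z-y-1})$. One has to tell apart two cases. * Completeness: there are $y$-element sets $S_1,\dots,S_k\subseteq[n]$ and a map $\psi:E\to[k]$ with $S_{\psi(T)}\subseteq T$ for all $T\in E$ and $|\psi^{-1}(i)|\le(1+\delta)|E|/k$ for all $i\in[k]$. * Soundness: for all $y$-element sets $S_1,\dots,S_k\subseteq[n]$, at most $\alpha|E|$ members of $E$ contain some $S_i$. This problem is called NP-hard if, for every constant $K$, it is NP-hard (under polynomial-time many-one reductions) on instances with $|E|\ge K\,k\,n^{z-y-1}$. **Theorem.** Assume that $(\alpha,z,y,\delta)$-Balanced Johnson Coverage$^*$ is NP-hard. Then for every constant $\varepsilon>0$ there is a constant $\rho>0$ such that, given a set $P$ of $N$ points with rational coordinates in $\mathbb{R}^d$, where $d=O(\log N)$ (the implied constant may depend on $\varepsilon$ and on the parameters), and an integer $1\le k\le N$, it is NP-hard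 to distinguish between the following two cases (partitions may have empty parts). * Completeness: there is a partition $P=P_1^*\sqcup\dots\sqcup P_k^*$ with $$\sum_{i=1}^k\sum_{p,q\in P_i^*}\|p-q\|_2^2\le(1+3\delta)(z-y)\,\frac{\rho N^2}{k}.$$ * Soundness: for every partition $P=P_1\sqcup\dots\sqcup P_k$, $$\sum_{i=1}^k\sum_{p,q\in P_i}\|p-q\|_2^2\ge(1-\varepsilon)\left(\alpha\sqrt{z-y}+(1-\alpha)\sqrt{z-y+1}\right)^2\frac{\rho N^2}{k}.$$ Moreover, with the same $\rho$ there is a constant $K$ such that for every $(n,k,E)$ as above with $|E|\ge K\,k\,n^{z-y-1}$, the set of characteristic vectors $P=\{\mathbf 1_T:T\in E\}\subset\mathbb{R}^n$ (so $N=|E|$) satisfies the completeness bound if $(n,k,E)$ is in the completeness case, and the soundness bound if it is in the soundness case. -/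

import Mathlib

/-! ### Data and programs: polynomial time, NP, NP-hardness of promise problems -/

/-- Finite binary trees, the data on which programs operate. They play the role of strings. -/
inductive Data : Type
  | nil : Data
  | pair : Data → Data → Data

namespace Data

/-- The number of nodes of a tree: the length of the data. -/
def size : Data → ℕ
  | nil => 1
  | pair a b => size a + size b + 1

def ofBool : Bool → Data
  | false => nil
  | true => pair nil nil

def ofList (l : List Data) : Data := l.foldr pair nil

/-- Natural numbers are written in binary, least significant bit first. -/
def ofNat (n : ℕ) : Data := ofList (n.bits.map ofBool)

/-- A sign bit and the absolute value. -/
def ofInt (m : ℤ) : Data := pair (ofBool (decide (m < 0))) (ofNat m.natAbs)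

/-- Numerator and denominator, in lowest terms. -/
def ofRat (q : ℚ) : Data := pair (ofInt q.num) (ofNat q.den)

end Data

/-- Programs of a small structured language on binary trees (`while`-programs: constants, the two
projections, pairing, composition, branching and a while-loop). -/
inductive Prog : Type
  | nil : Prog
  | id : Prog
  | fst : Prog
  | snd : Prog
  | pair : Prog → Prog → Prog
  | comp : Prog → Prog → Prog
  | ifNil : Prog → Prog → Prog → Prog
  | loop : Prog → Prog → Prog

/-- `Runs c a b t`: the program `c`, started on the data `a`, halts with the result `b` after `t`
steps. An elementary operation on data of size `s` is charged `s` steps, so that copying, reading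
and writing data is paid for, and the size of every intermediate value is at most the number of
steps. Polynomial time in this cost model is polynomial time on Turing machines. -/
inductive Runs : Prog → Data → Data → ℕ → Prop
  | nil (a : Data) : Runs Prog.nil a Data.nil a.size
  | id (a : Data) : Runs Prog.id a a a.size
  | fst_nil : Runs Prog.fst Data.nil Data.nil Data.nil.size
  | fst_pair (a b : Data) : Runs Prog.fst (Data.pair a b) a (Data.pair a b).size
  | snd_nil : Runs Prog.snd Data.nil Data.nil Data.nil.size
  | snd_pair (a b : Data) : Runs Prog.snd (Data.pair a b) b (Data.pair a b).size
  | pair {f g : Prog} {a b c : Data} {s t : ℕ} :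
      Runs f a b s → Runs g a c t → Runs (Prog.pair f g) a (Data.pair b c) (s + t + a.size)
  /-- `comp g f` runs `f` and then `g`. -/
  | comp {f g : Prog} {a b c : Data} {s t : ℕ} :
      Runs f a b s → Runs g b c t → Runs (Prog.comp g f) a c (s + t + a.size)
  /-- `ifNil c f g` runs `f` if the test `c` returns `nil`, and `g` otherwise. -/
  | ifNil_nil {c f g : Prog} {a b : Data} {s t : ℕ} :
      Runs c a Data.nil s → Runs f a b t → Runs (Prog.ifNil c f g) a b (s + t + a.size)
  | ifNil_pair {c f g : Prog} {a b u v : Data} {s t : ℕ} :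
      Runs c a (Data.pair u v) s → Runs g a b t → Runs (Prog.ifNil c f g) a b (s + t + a.size)
  /-- `loop c f` replaces the current value by its image under `f` as long as the test `c` does not
  return `nil`. -/
  | loop_nil {c f : Prog} {a : Data} {s : ℕ} :
      Runs c a Data.nil s → Runs (Prog.loop c f) a a (s + a.size)
  | loop_pair {c f : Prog} {a b r u v : Data} {s t t' : ℕ} :
      Runs c a (Data.pair u v) s → Runs f a b t → Runs (Prog.loop c f) b r t' →
        Runs (Prog.loop c f) a r (s + t + t' + a.size)

/-- `f` is computed by a program whose number of steps is bounded by a polynomial in the size of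
the input. -/
def PolyTimeComputable (f : Data → Data) : Prop :=
  ∃ (c : Prog) (p : Polynomial ℕ), ∀ a : Data, ∃ t : ℕ, t ≤ p.eval a.size ∧ Runs c a (f a) t

/-- The class NP: membership is witnessed by certificates of polynomial size that are checked in
polynomial time (the answer `nil` means rejection). -/
def InNP (L : Set Data) : Prop :=
  ∃ (V : Data → Data) (p : Polynomial ℕ), PolyTimeComputable V ∧
    ∀ x : Data, x ∈ L ↔ ∃ w : Data, w.size ≤ p.eval x.size ∧ V (Data.pair x w) ≠ Data.nil

/-- A promise problem: to tell apart the inputs in `yes` from those in `no`. -/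
structure PromiseProblem where
  yes : Set Data
  no : Set Data

/-- NP-hardness under polynomial-time many-one reductions. -/
def PromiseProblem.NPHard (Q : PromiseProblem) : Prop :=
  ∀ L : Set Data, InNP L → ∃ f : Data → Data, PolyTimeComputable f ∧
    (∀ x ∈ L, f x ∈ Q.yes) ∧ (∀ x ∉ L, f x ∈ Q.no)

/-! ### Johnson coverage -/

/-- `cov S E = {T ∈ E | S ⊆ T}`. -/
def cov {n : ℕ} (S : Finset (Fin n)) (E : Finset (Finset (Fin n))) : Finset (Finset (Fin n)) :=
  E.filter (fun T => S ⊆ T)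

/-- `f : A → B` is `δ`-balanced: every fibre has at most `(1 + δ) |A| / |B|` elements. -/
def IsBalanced {A B : Type*} (δ : ℝ) (f : A → B) : Prop :=
  ∀ b : B, (Nat.card {a : A // f a = b} : ℝ) ≤ (1 + δ) * (Nat.card A / Nat.card B)

/-- An instance `(U, E, k)` with `U = Fin n`; the collection `E` is given by a list without
repetition. -/
structure CoverageInstance where
  n : ℕ
  k : ℕ
  sets : List (Finset (Fin n))
  nodup : sets.Nodup

namespace CoverageInstance

def E (I : CoverageInstance) : Finset (Finset (Fin I.n)) := I.sets.toFinset

/-- The input `(n, k, E)`: numbers in binary, sets as increasing lists of their elements. -/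
def encode (I : CoverageInstance) : Data :=
  Data.pair (Data.ofNat I.n) (Data.pair (Data.ofNat I.k)
    (Data.ofList (I.sets.map fun T =>
      Data.ofList ((T.sort (· ≤ ·)).map fun i => Data.ofNat i.val))))

/-- `E` consists of `z`-subsets of `[n]`, and `|E| ≥ K · k · n ^ (z - y - 1)`. -/
def IsDense (I : CoverageInstance) (z y K : ℕ) : Prop :=
  z ≤ I.n ∧ 1 ≤ I.k ∧ (∀ T ∈ I.E, T.card = z) ∧ K * (I.k * I.n ^ (z - y - 1)) ≤ I.E.card

/-- Completeness: there are `y`-sets `S₁, …, S_k` and a `δ`-balanced assignment `ψ : E → [k]` of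
the members of `E` such that every `T ∈ E` contains `S_{ψ(T)}`. -/
def Complete (I : CoverageInstance) (y : ℕ) (δ : ℝ) : Prop :=
  ∃ (S : Fin I.k → Finset (Fin I.n)) (ψ : {T // T ∈ I.E} → Fin I.k),
    (∀ i, (S i).card = y) ∧ IsBalanced δ ψ ∧ ∀ T : {T // T ∈ I.E}, S (ψ T) ⊆ T.val

/-- Soundness: any `k` `y`-sets cover at most `α |E|` members of `E`. -/
def Sound (I : CoverageInstance) (y : ℕ) (α : ℝ) : Prop :=
  ∀ S : Fin I.k → Finset (Fin I.n), (∀ i, (S i).card = y) →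
    ((Finset.univ.biUnion fun i => cov (S i) I.E).card : ℝ) ≤ α * I.E.card

end CoverageInstance

/-- The gap problem on the instances with `|E| ≥ K · k · |U| ^ (z - y - 1)`. -/
def balancedJohnsonCoverage (α : ℝ) (z y : ℕ) (δ : ℝ) (K : ℕ) : PromiseProblem where
  yes := {x | ∃ I : CoverageInstance, x = I.encode ∧ I.IsDense z y K ∧ I.Complete y δ}
  no := {x | ∃ I : CoverageInstance, x = I.encode ∧ I.IsDense z y K ∧ I.Sound y α}

/-- NP-hardness of `(α, z, y, δ)`-Balanced Johnson Coverage*, the problem on instances with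
`|E| = ω(k · |U| ^ (z - y - 1))`: hardness persists beyond every constant multiple of
`k · |U| ^ (z - y - 1)`. -/
def BalancedJohnsonCoverageStarNPHard (α : ℝ) (z y : ℕ) (δ : ℝ) : Prop :=
  ∀ K : ℕ, (balancedJohnsonCoverage α z y δ K).NPHard

/-! ### Min-sum clustering -/

/-- `P₁ ⊔ ⋯ ⊔ P_k = P`; parts may be empty. -/
def IsClustering {X : Type*} {k : ℕ} (P : Finset X) (C : Fin k → Finset X) : Prop :=
  (∀ i j, i ≠ j → Disjoint (C i) (C j)) ∧ ∀ p, p ∈ P ↔ ∃ i, p ∈ C i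

/-- The min-sum cost for squared Euclidean distances, summed over ordered pairs. -/
noncomputable def minSumCost {d k : ℕ} (C : Fin k → Finset (EuclideanSpace ℝ (Fin d))) : ℝ :=
  ∑ i, ∑ p ∈ C i, ∑ q ∈ C i, ‖p - q‖ ^ 2

/-- Some `k`-clustering of `P` costs at most `a |P|² / k`. -/
def SomeCostAtMost {d : ℕ} (P : Finset (EuclideanSpace ℝ (Fin d))) (k : ℕ) (a : ℝ) : Prop :=
  ∃ C : Fin k → Finset (EuclideanSpace ℝ (Fin d)), IsClustering P C ∧
    minSumCost C ≤ a * (P.card : ℝ) ^ 2 / k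

/-- Every `k`-clustering of `P` costs at least `b |P|² / k`. -/
def EveryCostAtLeast {d : ℕ} (P : Finset (EuclideanSpace ℝ (Fin d))) (k : ℕ) (b : ℝ) : Prop :=
  ∀ C : Fin k → Finset (EuclideanSpace ℝ (Fin d)), IsClustering P C →
    b * (P.card : ℝ) ^ 2 / k ≤ minSumCost C

/-- A finite set of points with rational coordinates (listed without repetition) and a number of
clusters. -/
structure ClusteringInstance where
  d : ℕ
  k : ℕ
  points : List (Fin d → ℚ)
  nodup : points.Nodup

namespace ClusteringInstance

open Classical in
/-- The points as a subset of Euclidean space. -/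
noncomputable def P (I : ClusteringInstance) : Finset (EuclideanSpace ℝ (Fin I.d)) :=
  (I.points.map fun v => (WithLp.toLp 2 fun j => (v j : ℝ) : EuclideanSpace ℝ (Fin I.d))).toFinset

/-- The input `(k, P)`: points as lists of rational coordinates, numbers in binary. -/
def encode (I : ClusteringInstance) : Data :=
  Data.pair (Data.ofNat I.k)
    (Data.ofList (I.points.map fun v => Data.ofList ((List.ofFn v).map Data.ofRat)))

/-- `1 ≤ k ≤ |P|` and the dimension is at most `D log |P|`. -/
def IsAdmissible (I : ClusteringInstance) (D : ℝ) : Prop :=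
  1 ≤ I.k ∧ I.k ≤ I.P.card ∧ (I.d : ℝ) ≤ D * Real.log I.P.card

end ClusteringInstance

/-- To tell apart the point sets in dimension at most `D log |P|` with some `k`-clustering of cost
at most `a |P|² / k` from those all of whose `k`-clusterings cost at least `b |P|² / k`. -/
def minSumClusteringGap (D a b : ℝ) : PromiseProblem where
  yes := {x | ∃ I : ClusteringInstance, x = I.encode ∧ I.IsAdmissible D ∧ SomeCostAtMost I.P I.k a}
  no := {x | ∃ I : ClusteringInstance, x = I.encode ∧ I.IsAdmissible D ∧ EveryCostAtLeast I.P I.k b}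

open Classical in
/-- The characteristic vectors of the members of `E`, as points of `ℝⁿ`. -/
noncomputable def CoverageInstance.charPoints (I : CoverageInstance) :
    Finset (EuclideanSpace ℝ (Fin I.n)) :=
  I.E.image fun T => WithLp.toLp 2 fun i => if i ∈ T then (1 : ℝ) else 0

/-- The constant `(α √(z - y) + (1 - α) √(z - y + 1))²`. -/
noncomputable def soundnessConstant (α : ℝ) (z y : ℕ) : ℝ :=
  (α * √((z : ℝ) - y) + (1 - α) * √((z : ℝ) - y + 1)) ^ 2

/-!
For a family `𝒞` of `m` sets of size `z`, the squared distance of two characteristic vectors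
`1_T, 1_T'` is `2 (z - |T ∩ T'|)`, so the cost of a cluster is a matter of the average intersection
of two of its members.

*Completeness.* If all members of each cluster contain a common `y`-set, every distance is at most
`2 (z - y)`, and balance bounds the sum of the squares of the cluster sizes
(`CoverageInstance.Complete.someCostAtMost`).

*Soundness.* The sum of all `|T ∩ T'|` is at most `(y - 1) m² + A`, where `A` is the sum over all
`y`-sets `S` of the square of the number of members of `𝒞` containing `S` (`sum_card_inter_le`).
Two different `y`-sets have a union of at least `y + 1` elements, which only `n ^ (z - y - 1)` sets
of size `z` contain; so by Cauchy–Schwarz `A ≤ (β + o(1)) m²` when `m` is large compared with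
`n ^ (z - y - 1)` and no `y`-set is contained in more than a proportion `β` of the members
(`sum_sq_card_cov_le`). Hence a cluster costs at least about `2 m² (z - y + 1 - β)`. The clusters
that are too small for this contain few points because `|E|` is large compared with
`k n ^ (z - y - 1)`. Cauchy–Schwarz over the `k` clusters and the concavity of the square root give
the constant of the theorem (`CoverageInstance.Sound.everyCostAtLeast`). All of this only uses the
distances up to a factor `1 ± η`, and the constant `ρ = 2 (1 + η)` serves every point set with
this property.

*Dimension.* The unit vectors of `ℝⁿ` are replaced by almost orthogonal sign vectors in dimension
`d = O(log N)`, and `1_T` by the sum of the vectors of the members of `T`, divided by `√d`. This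
changes the squared distances by a factor `1 ± O(z / c)` if all inner products are at most `d / c`
(`CoverageInstance.abs_norm_point_sub_sq_sub_le`). The sign vectors are found without randomness:
there are only `2 ^ d = N ^ O(1)` candidates, and they are chosen greedily. By Chernoff's bound
each chosen vector excludes a small proportion of the candidates, so enough of them are found
(`one_le_length_greedyCode`). Words are given out to the members of the sets of `E` only, since
`n` itself may be exponential in the size of the input when `z = y + 1`. The dimension is a power
of `4`, so that `√d` is a power of `2`. A translation turns the sums of signs into sums of bits;
the coordinates are then fractions `m / 2 ^ s` with `0 ≤ m ≤ z`, which finitely many cases bring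
into lowest terms (`PolyTime.min_div_two_pow`).

*Polynomial time.* The functions between types of data that programs compute in polynomial time
contain projections, pairing, case distinctions and compositions, and are closed under folding over
a list as long as the intermediate values have polynomial size (`PolyTime.foldl`). The reduction is
a composition of such folds (`PolyTime.reduction`).
-/

/-! ### Functions computed in polynomial time -/

namespace Data

theorem size_pos (a : Data) : 1 ≤ a.size := by
  cases a <;> simp [size]

end Data

/-- A program has to pay for writing its result. -/
theorem Runs.output_size_le {c : Prog} {a b : Data} {t : ℕ} (h : Runs c a b t) : b.size ≤ t := by
  induction h with
  | nil a => exact a.size_pos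
  | id a => exact le_rfl
  | fst_nil => exact le_rfl
  | fst_pair a b => simp only [Data.size]; omega
  | snd_nil => exact le_rfl
  | snd_pair a b => simp only [Data.size]; omega
  | @pair _ _ a _ _ _ _ _ _ ih₁ ih₂ => have := a.size_pos; simp only [Data.size]; omega
  | comp _ _ ih₁ ih₂ => omega
  | ifNil_nil _ _ ih₁ ih₂ => omega
  | ifNil_pair _ _ ih₁ ih₂ => omega
  | loop_nil _ ih => omega
  | loop_pair _ _ _ ih₁ ih₂ ih₃ => omega

theorem Polynomial.eval_mono_nat (p : Polynomial ℕ) {a b : ℕ} (h : a ≤ b) :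
    p.eval a ≤ p.eval b := by
  rw [Polynomial.eval_eq_sum_range, Polynomial.eval_eq_sum_range]
  gcongr

/-- One program computes the datum `t i` from the datum `s i`, for every index `i`, in time
polynomial in the size of `s i`. Data that are not of the form `s i` need not be treated. -/
def Computes {ι : Type*} (s t : ι → Data) : Prop :=
  ∃ (c : Prog) (p : Polynomial ℕ), ∀ i, ∃ n ≤ p.eval (s i).size, Runs c (s i) (t i) n

namespace Computes

variable {ι κ : Type*} {s t u v : ι → Data}

theorem reindex (h : Computes s t) (φ : κ → ι) :
    Computes (fun i => s (φ i)) (fun i => t (φ i)) := by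
  obtain ⟨c, p, h⟩ := h
  exact ⟨c, p, fun i => h (φ i)⟩

theorem size_le (h : Computes s t) : ∃ p : Polynomial ℕ, ∀ i, (t i).size ≤ p.eval (s i).size := by
  obtain ⟨c, p, h⟩ := h
  refine ⟨p, fun i => ?_⟩
  obtain ⟨n, hn, hr⟩ := h i
  exact hr.output_size_le.trans hn

theorem congr (h : Computes s t) (htu : ∀ i, t i = u i) : Computes s u := by
  rwa [← funext htu]

theorem refl (s : ι → Data) : Computes s s :=
  ⟨Prog.id, Polynomial.X, fun i => ⟨_, by simp, Runs.id _⟩⟩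

theorem trans (h₁ : Computes s t) (h₂ : Computes t u) : Computes s u := by
  obtain ⟨c, p, h₁⟩ := h₁
  obtain ⟨d, q, h₂⟩ := h₂
  refine ⟨Prog.comp d c, p + q.comp p + Polynomial.X, fun i => ?_⟩
  obtain ⟨m, hm, hr⟩ := h₁ i
  obtain ⟨n, hn, hr'⟩ := h₂ i
  refine ⟨m + n + (s i).size, ?_, Runs.comp hr hr'⟩
  have := hn.trans (q.eval_mono_nat (hr.output_size_le.trans hm))
  simp only [Polynomial.eval_add, Polynomial.eval_comp, Polynomial.eval_X]
  omega

theorem pair (h₁ : Computes s t) (h₂ : Computes s u) :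
    Computes s (fun i => Data.pair (t i) (u i)) := by
  obtain ⟨c, p, h₁⟩ := h₁
  obtain ⟨d, q, h₂⟩ := h₂
  refine ⟨Prog.pair c d, p + q + Polynomial.X, fun i => ?_⟩
  obtain ⟨m, hm, hr⟩ := h₁ i
  obtain ⟨n, hn, hr'⟩ := h₂ i
  refine ⟨m + n + (s i).size, ?_, Runs.pair hr hr'⟩
  simp only [Polynomial.eval_add, Polynomial.eval_X]
  omega

theorem fst (h : Computes s (fun i => Data.pair (t i) (u i))) : Computes s t :=
  h.trans ⟨Prog.fst, Polynomial.X, fun i => ⟨_, by simp, Runs.fst_pair _ _⟩⟩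

theorem snd (h : Computes s (fun i => Data.pair (t i) (u i))) : Computes s u :=
  h.trans ⟨Prog.snd, Polynomial.X, fun i => ⟨_, by simp, Runs.snd_pair _ _⟩⟩

/-- The program with the constant value `b`. -/
def constProg : Data → Prog
  | Data.nil => Prog.nil
  | Data.pair a b => Prog.pair (constProg a) (constProg b)

theorem runs_constProg (b a : Data) : ∃ n ≤ 2 * b.size * a.size, Runs (constProg b) a b n := by
  induction b with
  | nil => exact ⟨_, by simp only [Data.size]; omega, Runs.nil a⟩
  | pair b₁ b₂ ih₁ ih₂ =>
    obtain ⟨m, hm, hr⟩ := ih₁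
    obtain ⟨n, hn, hr'⟩ := ih₂
    refine ⟨m + n + a.size, ?_, Runs.pair hr hr'⟩
    simp only [Data.size]
    nlinarith

theorem const (s : ι → Data) (b : Data) : Computes s (fun _ => b) := by
  refine ⟨constProg b, Polynomial.C (2 * b.size) * Polynomial.X, fun i => ?_⟩
  simpa using runs_constProg b (s i)

open Classical in
/-- Branching on whether a computed datum is `nil`. -/
theorem ifNil (hc : Computes s t) (h₁ : Computes s u) (h₂ : Computes s v) :
    Computes s (fun i => if t i = Data.nil then u i else v i) := by
  obtain ⟨c, p, hc⟩ := hc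
  obtain ⟨c₁, p₁, h₁⟩ := h₁
  obtain ⟨c₂, p₂, h₂⟩ := h₂
  refine ⟨Prog.ifNil c c₁ c₂, p + p₁ + p₂ + Polynomial.X, fun i => ?_⟩
  obtain ⟨m, hm, hr⟩ := hc i
  obtain ⟨n₁, hn₁, hr₁⟩ := h₁ i
  obtain ⟨n₂, hn₂, hr₂⟩ := h₂ i
  simp only [Polynomial.eval_add, Polynomial.eval_X]
  cases hti : t i with
  | nil =>
    rw [hti] at hr
    exact ⟨m + n₁ + (s i).size, by omega, by simpa using Runs.ifNil_nil hr hr₁⟩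
  | pair a b =>
    rw [hti] at hr
    exact ⟨m + n₂ + (s i).size, by omega, by simpa using Runs.ifNil_pair hr hr₂⟩

end Computes

/-- A type whose elements are written as data. -/
class HasData (α : Type*) where
  toData : α → Data

open HasData (toData)

instance : HasData Unit := ⟨fun _ => Data.nil⟩
instance : HasData Bool := ⟨Data.ofBool⟩
instance : HasData ℕ := ⟨Data.ofNat⟩
instance : HasData ℚ := ⟨Data.ofRat⟩
instance {α β : Type*} [HasData α] [HasData β] : HasData (α × β) :=
  ⟨fun x => Data.pair (toData x.1) (toData x.2)⟩
instance {α : Type*} [HasData α] : HasData (List α) := ⟨fun l => Data.ofList (l.map toData)⟩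

/-- The size of an element, written as data. -/
def dsize {α : Type*} [HasData α] (a : α) : ℕ := (toData a).size

/-- `f` is computed by a program in time polynomial in the size of the input. -/
def PolyTime {α β : Type*} [HasData α] [HasData β] (f : α → β) : Prop :=
  Computes (toData : α → Data) (fun a => toData (f a))

section dsize

variable {α β : Type*} [HasData α] [HasData β]

theorem dsize_pos (a : α) : 1 ≤ dsize a := Data.size_pos _

@[simp] theorem dsize_unit (a : Unit) : dsize a = 1 := rfl

theorem dsize_bool_le (b : Bool) : dsize b ≤ 3 := by
  cases b <;> simp [dsize, toData, Data.ofBool, Data.size]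

@[simp] theorem dsize_prod (x : α × β) : dsize x = dsize x.1 + dsize x.2 + 1 := rfl

@[simp] theorem dsize_nil : dsize ([] : List α) = 1 := rfl

@[simp] theorem dsize_cons (a : α) (l : List α) : dsize (a :: l) = dsize a + dsize l + 1 := rfl

theorem dsize_append_add_one (l l' : List α) :
    dsize (l ++ l') + 1 = dsize l + dsize l' := by
  induction l with
  | nil => simp; omega
  | cons a l ih => simp; omega

theorem dsize_append_le (l l' : List α) : dsize (l ++ l') ≤ dsize l + dsize l' := by
  have := dsize_append_add_one l l'
  omega

theorem length_lt_dsize (l : List α) : l.length < dsize l := by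
  induction l with
  | nil => simp
  | cons a l ih => simp; omega

theorem dsize_le_of_mem {l : List α} {a : α} (h : a ∈ l) : dsize a ≤ dsize l := by
  induction l with
  | nil => simp at h
  | cons b l ih =>
    rcases List.mem_cons.1 h with rfl | h
    · simp; omega
    · have := ih h
      simp; omega

theorem dsize_tail_le (l : List α) : dsize l.tail ≤ dsize l := by
  cases l <;> simp; omega

theorem dsize_le_of_forall {l : List α} {B : ℕ} (h : ∀ a ∈ l, dsize a ≤ B) :
    dsize l ≤ l.length * (B + 1) + 1 := by
  induction l with
  | nil => simp
  | cons a l ih =>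
    have h1 := h a (by simp)
    have h2 := ih (fun b hb => h b (by simp [hb]))
    simp only [dsize_cons, List.length_cons]
    nlinarith

end dsize

namespace PolyTime

variable {α β γ δ : Type*} [HasData α] [HasData β] [HasData γ] [HasData δ]

theorem dsize_le {f : α → β} (hf : PolyTime f) :
    ∃ p : Polynomial ℕ, ∀ a, dsize (f a) ≤ p.eval (dsize a) := hf.size_le

theorem id : PolyTime (fun a : α => a) := Computes.refl _

theorem congr {f g : α → β} (hf : PolyTime f) (hfg : ∀ a, f a = g a) : PolyTime g := by
  rwa [← funext hfg]

theorem comp {g : β → γ} {f : α → β} (hg : PolyTime g) (hf : PolyTime f) :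
    PolyTime (fun a => g (f a)) :=
  Computes.trans hf (Computes.reindex hg f)

theorem const (b : β) : PolyTime (fun _ : α => b) := Computes.const _ _

theorem prod {f : α → β} {g : α → γ} (hf : PolyTime f) (hg : PolyTime g) :
    PolyTime (fun a => (f a, g a)) := Computes.pair hf hg

theorem fst {f : α → β × γ} (hf : PolyTime f) : PolyTime (fun a => (f a).1) :=
  Computes.fst (u := fun a => toData (f a).2) hf

theorem snd {f : α → β × γ} (hf : PolyTime f) : PolyTime (fun a => (f a).2) :=
  Computes.snd (t := fun a => toData (f a).1) hf

theorem cons {f : α → β} {g : α → List β} (hf : PolyTime f) (hg : PolyTime g) :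
    PolyTime (fun a => f a :: g a) := Computes.pair hf hg

theorem tail {f : α → List β} (hf : PolyTime f) : PolyTime (fun a => (f a).tail) := by
  refine comp (g := fun l : List β => l.tail) ⟨Prog.snd, Polynomial.X, fun l => ?_⟩ hf
  rw [Polynomial.eval_X]
  cases l with
  | nil => exact ⟨_, le_rfl, Runs.snd_nil⟩
  | cons b l => exact ⟨_, le_rfl, Runs.snd_pair _ _⟩

/-- The projection of `nil` is `nil`, so the head of an empty list is read as the element that is
written `nil`. -/
theorem headD {f : α → List β} (hf : PolyTime f) {b : β} (hb : toData b = Data.nil) :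
    PolyTime (fun a => (f a).headD b) := by
  refine comp (g := fun l : List β => l.headD b) ⟨Prog.fst, Polynomial.X, fun l => ?_⟩ hf
  rw [Polynomial.eval_X]
  cases l with
  | nil =>
    change ∃ n ≤ _, Runs Prog.fst Data.nil (toData b) n
    rw [hb]
    exact ⟨_, le_rfl, Runs.fst_nil⟩
  | cons b l => exact ⟨_, le_rfl, Runs.fst_pair _ _⟩

theorem cond {c : α → Bool} {f g : α → β} (hc : PolyTime c) (hf : PolyTime f) (hg : PolyTime g) :
    PolyTime (fun a => bif c a then f a else g a) := by
  refine (Computes.ifNil hc hg hf).congr fun a => ?_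
  cases h : c a <;> simp [toData, Data.ofBool, h]

theorem isEmpty {f : α → List β} (hf : PolyTime f) : PolyTime (fun a => (f a).isEmpty) := by
  refine (Computes.ifNil hf (Computes.const _ (toData true))
    (Computes.const _ (toData false))).congr fun a => ?_
  cases h : f a <;> simp [toData, Data.ofList, h]

theorem and {f g : α → Bool} (hf : PolyTime f) (hg : PolyTime g) :
    PolyTime (fun a => f a && g a) := by
  have := hf.cond hg (const false)
  refine this.congr fun a => ?_
  cases f a <;> rfl

theorem not {f : α → Bool} (hf : PolyTime f) : PolyTime (fun a => !f a) := by
  have := hf.cond (const false) (const true)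
  refine this.congr fun a => ?_
  cases f a <;> rfl

theorem beq {f g : α → Bool} (hf : PolyTime f) (hg : PolyTime g) :
    PolyTime (fun a => f a == g a) := by
  have := hf.cond hg hg.not
  refine this.congr fun a => ?_
  cases f a <;> cases g a <;> rfl

/-- The loop that folds over a list, keeping `(x, b, l)`: the input, the value so far, and what
is left of the list. `S` bounds the size of every state that occurs. -/
theorem exists_runs_loop {f : δ × β × α → β} {test step : Prog} {p q : Polynomial ℕ}
    (htest : ∀ z : δ × β × List α, ∃ n ≤ p.eval (dsize z), Runs test (toData z) (toData z.2.2) n)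
    (hstep : ∀ z : δ × β × α × List α, ∃ n ≤ q.eval (dsize z),
      Runs step (toData z) (toData (z.1, f (z.1, z.2.1, z.2.2.1), z.2.2.2)) n)
    (x : δ) (S : ℕ) (l : List α) (b : β)
    (hS : ∀ l₁ l₂, l = l₁ ++ l₂ →
      dsize (x, l₁.foldl (fun b a => f (x, b, a)) b, l₂) ≤ S) :
    ∃ n ≤ (l.length + 1) * (p.eval S + q.eval S + S),
      Runs (Prog.loop test step) (toData (x, b, l))
        (toData (x, l.foldl (fun b a => f (x, b, a)) b, ([] : List α))) n := by
  induction l generalizing b with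
  | nil =>
    obtain ⟨n, hn, hr⟩ := htest (x, b, [])
    have h := hS [] [] rfl
    refine ⟨n + (toData (x, b, ([] : List α))).size, ?_, Runs.loop_nil hr⟩
    have h₁ := p.eval_mono_nat h
    change n + dsize (x, b, ([] : List α)) ≤ _
    simp only [List.foldl_nil] at *
    simp only [List.length_nil]
    omega
  | cons a l ih =>
    obtain ⟨n, hn, hr⟩ := htest (x, b, a :: l)
    obtain ⟨m, hm, hr'⟩ := hstep (x, b, a, l)
    obtain ⟨r, hr₁, hr''⟩ := ih (f (x, b, a)) (by
      intro l₁ l₂ h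
      exact hS (a :: l₁) l₂ (by simp [h]))
    have h : dsize (x, b, a :: l) ≤ S := hS [] (a :: l) rfl
    refine ⟨n + m + r + dsize (x, b, a :: l), ?_, Runs.loop_pair hr hr' hr''⟩
    have h₁ := p.eval_mono_nat h
    have h₂ := q.eval_mono_nat h
    have h₃ : m ≤ q.eval (dsize (x, b, a :: l)) := hm
    simp only [List.length_cons]
    have : (l.length + 1 + 1) * (p.eval S + q.eval S + S) =
      (l.length + 1) * (p.eval S + q.eval S + S) + (p.eval S + q.eval S + S) := by ring
    omega

/-- Folding over a list takes polynomial time if the intermediate values have polynomial size. -/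
theorem foldl {g : δ → β} {h : δ → List α} {f : δ × β × α → β} (hg : PolyTime g)
    (hh : PolyTime h) (hf : PolyTime f)
    (hb : ∃ r : Polynomial ℕ, ∀ x l, l <+: h x →
      dsize (l.foldl (fun b a => f (x, b, a)) (g x)) ≤ r.eval (dsize x)) :
    PolyTime (fun x => (h x).foldl (fun b a => f (x, b, a)) (g x)) := by
  obtain ⟨r, hr⟩ := hb
  obtain ⟨ph, hph⟩ := hh.dsize_le
  have htest : PolyTime (fun z : δ × β × List α => z.2.2) := id.snd.snd
  have hstep : Computes (fun z : δ × β × α × List α => toData z)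
      (fun z => toData (z.1, f (z.1, z.2.1, z.2.2.1), z.2.2.2)) :=
    have h1 : PolyTime (fun z : δ × β × α × List α => f (z.1, z.2.1, z.2.2.1)) :=
      hf.comp (id.fst.prod (id.snd.fst.prod id.snd.snd.fst))
    id.fst.prod (h1.prod id.snd.snd.snd)
  obtain ⟨test, p, htest⟩ := htest
  obtain ⟨step, q, hstep⟩ := hstep
  have hloop : Computes (fun x => toData (x, g x, h x))
      (fun x => toData (x, (h x).foldl (fun b a => f (x, b, a)) (g x), ([] : List α))) := by
    let S : Polynomial ℕ := Polynomial.X + r + ph + Polynomial.C 2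
    refine ⟨Prog.loop test step, (ph + 1) * (p.comp S + q.comp S + S), fun x => ?_⟩
    obtain ⟨n, hn, hrun⟩ := exists_runs_loop htest hstep x (S.eval (dsize x)) (h x) (g x) (by
      intro l₁ l₂ hl
      have h1 := hr x l₁ ⟨l₂, hl.symm⟩
      have h2 := hph x
      rw [hl] at h2
      have h3 := dsize_append_add_one l₁ l₂
      have h4 := dsize_pos l₁
      simp only [dsize_prod, S, Polynomial.eval_add, Polynomial.eval_X, Polynomial.eval_C]
      omega)
    refine ⟨n, hn.trans ?_, hrun⟩
    have h5 : dsize x ≤ (toData (x, g x, h x)).size := by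
      change _ ≤ dsize (x, g x, h x)
      simp only [dsize_prod]; omega
    have h6 := length_lt_dsize (h x)
    have h7 := hph x
    have h8 := ph.eval_mono_nat h5
    have h9 := S.eval_mono_nat h5
    have h10 := p.eval_mono_nat h9
    have h11 := q.eval_mono_nat h9
    simp only [Polynomial.eval_mul, Polynomial.eval_add, Polynomial.eval_comp, Polynomial.eval_one]
    exact Nat.mul_le_mul (by omega) (by omega)
  have h1 : Computes (toData : δ → Data) (fun x => toData (x, g x, h x)) := id.prod (hg.prod hh)
  have h2 := h1.trans hloop
  exact Computes.fst (u := fun _ => toData ([] : List α)) (Computes.snd (t := fun x => toData x) h2)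

/-- Folding takes polynomial time if each step adds at most a polynomial to the size. -/
theorem foldl_of_add {g : δ → β} {h : δ → List α} {f : δ × β × α → β} (hg : PolyTime g)
    (hh : PolyTime h) (hf : PolyTime f)
    (hb : ∃ r : Polynomial ℕ, ∀ x b, ∀ a ∈ h x, dsize (f (x, b, a)) ≤ dsize b + r.eval (dsize x)) :
    PolyTime (fun x => (h x).foldl (fun b a => f (x, b, a)) (g x)) := by
  obtain ⟨r, hr⟩ := hb
  obtain ⟨ph, hph⟩ := hh.dsize_le
  obtain ⟨pg, hpg⟩ := hg.dsize_le
  refine foldl hg hh hf ⟨pg + ph * r, fun x l hl => ?_⟩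
  have key : ∀ (l : List α) (b : β), (∀ a ∈ l, a ∈ h x) →
      dsize (l.foldl (fun b a => f (x, b, a)) b) ≤ dsize b + l.length * r.eval (dsize x) := by
    intro l
    induction l with
    | nil => intro b _; simp
    | cons a l ih =>
      intro b hl
      have h1 := ih (f (x, b, a)) (fun a' ha' => hl a' (by simp [ha']))
      have h2 := hr x b a (hl a (by simp))
      simp only [List.foldl_cons, List.length_cons]
      nlinarith
  have h1 := key l (g x) (fun a ha => hl.subset ha)
  have h2 := hl.length_le
  have h3 := length_lt_dsize (h x)
  have h4 := hph x
  have h5 := hpg x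
  simp only [Polynomial.eval_add, Polynomial.eval_mul]
  have h6 : l.length * r.eval (dsize x) ≤ ph.eval (dsize x) * r.eval (dsize x) :=
    Nat.mul_le_mul (by omega) le_rfl
  omega

theorem reverse {f : α → List β} (hf : PolyTime f) : PolyTime (fun a => (f a).reverse) := by
  have := foldl_of_add (g := fun _ => ([] : List β)) (f := fun z : α × List β × β => z.2.2 :: z.2.1)
    (const _) hf (id.snd.snd.cons id.snd.fst) (by
      obtain ⟨p, hp⟩ := hf.dsize_le
      refine ⟨p + 1, fun x b a ha => ?_⟩
      have h1 := dsize_le_of_mem ha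
      have h2 := hp x
      simp
      omega)
  refine this.congr fun a => ?_
  simp

theorem append {f g : α → List β} (hf : PolyTime f) (hg : PolyTime g) :
    PolyTime (fun a => f a ++ g a) := by
  have := foldl_of_add (f := fun z : α × List β × β => z.2.2 :: z.2.1)
    hg hf.reverse (id.snd.snd.cons id.snd.fst) (by
      obtain ⟨p, hp⟩ := hf.dsize_le
      refine ⟨p + 1, fun x b a ha => ?_⟩
      have h1 := dsize_le_of_mem (List.mem_reverse.1 ha)
      have h2 := hp x
      simp
      omega)
  refine this.congr fun a => ?_
  simp

/-- Applying to each entry of a list a function that may also depend on the input. -/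
theorem map {h : δ → List α} {f : δ × α → β} (hh : PolyTime h) (hf : PolyTime f) :
    PolyTime (fun x => (h x).map (fun a => f (x, a))) := by
  have := foldl_of_add (g := fun _ => ([] : List β))
    (f := fun z : δ × List β × α => f (z.1, z.2.2) :: z.2.1)
    (const _) hh.reverse ((hf.comp (id.fst.prod id.snd.snd)).cons id.snd.fst) (by
      obtain ⟨p, hp⟩ := hh.dsize_le
      obtain ⟨q, hq⟩ := hf.dsize_le
      refine ⟨q.comp (Polynomial.X + p + 1) + 1, fun x b a ha => ?_⟩
      have h1 := dsize_le_of_mem (List.mem_reverse.1 ha)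
      have h2 := hp x
      have h3 := hq (x, a)
      have h4 : dsize (x, a) ≤ dsize x + p.eval (dsize x) + 1 := by simp; omega
      have h5 := q.eval_mono_nat h4
      simp only [Polynomial.eval_add, Polynomial.eval_comp, Polynomial.eval_X, Polynomial.eval_one,
        dsize_cons]
      omega)
  refine this.congr fun a => ?_
  simp [List.foldl_reverse]

end PolyTime

/-! ### Arithmetic on unary and binary numbers in polynomial time -/

@[simp] theorem dsize_unary (l : List Unit) : dsize l = 2 * l.length + 1 := by
  induction l with
  | nil => rfl
  | cons a l ih => simp only [dsize_cons, dsize_unit, ih, List.length_cons]; omega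

/-- Half of a number in unary, rounded down. -/
def halve (l : List Unit) : List Unit :=
  (l.foldl (fun (s : Bool × List Unit) _ => bif s.1 then (false, () :: s.2) else (true, s.2))
    (false, [])).2

@[simp] theorem length_halve (l : List Unit) : (halve l).length = l.length / 2 := by
  have key : ∀ (l : List Unit) (s : Bool × List Unit),
      (l.foldl (fun (s : Bool × List Unit) _ => bif s.1 then (false, () :: s.2) else (true, s.2))
        s).2.length = s.2.length + (l.length + s.1.toNat) / 2 := by
    intro l
    induction l with
    | nil => rintro ⟨b, t⟩; cases b; all_goals simp
    | cons a l ih =>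
      rintro ⟨b, t⟩
      rw [List.foldl_cons, ih]
      cases b
      all_goals simp
      all_goals omega
  simpa [halve] using key l (false, [])

/-- The number of digits of a number in unary, where `q` divides by the base. -/
def digitCount (q : List Unit → List Unit) (l : List Unit) : List Unit :=
  (l.foldl (fun (s : List Unit × List Unit) _ => bif s.1.isEmpty then s else (q s.1, () :: s.2))
    (l, [])).2

theorem digitCount_spec {q : List Unit → List Unit} {b : ℕ} (hb : 2 ≤ b)
    (hq : ∀ l, (q l).length = l.length / b) (l : List Unit) :
    l.length < b ^ (digitCount q l).length ∧
      b ^ (digitCount q l).length ≤ b * l.length + 1 := by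
  have key : ∀ (l' : List Unit) (s : List Unit × List Unit) (i : ℕ),
      s.1.length = l.length / b ^ s.2.length → b ^ s.2.length ≤ b * l.length + 1 →
      (s.1 = [] ∨ s.2.length = i) →
      let s' := l'.foldl
        (fun (s : List Unit × List Unit) _ => bif s.1.isEmpty then s else (q s.1, () :: s.2)) s
      s'.1.length = l.length / b ^ s'.2.length ∧ b ^ s'.2.length ≤ b * l.length + 1 ∧
      (s'.1 = [] ∨ s'.2.length = i + l'.length) := by
    intro l'
    induction l' with
    | nil => intro s i h1 h2 h3; exact ⟨h1, h2, h3⟩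
    | cons a l' ih =>
      rintro ⟨t, u⟩ i h1 h2 h3
      rw [List.foldl_cons, List.length_cons]
      cases t with
      | nil =>
        have := ih ([], u) i h1 h2 (Or.inl rfl)
        refine ⟨this.1, this.2.1, Or.inl ?_⟩
        have h4 : ∀ l' : List Unit, (l'.foldl (fun (s : List Unit × List Unit) _ =>
            bif s.1.isEmpty then s else (q s.1, () :: s.2)) ([], u)).1 = [] := by
          intro l'
          induction l' with
          | nil => rfl
          | cons a l' ih => simpa using ih
        exact h4 l'
      | cons c t =>
        have h4 : (c :: t).length ≠ 0 := by simp
        have h5 : b ^ u.length ≤ l.length := by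
          by_contra hlt
          rw [not_le] at hlt
          exact h4 (h1.trans (Nat.div_eq_of_lt hlt))
        have := ih (q (c :: t), () :: u) (i + 1)
          (by rw [hq, h1, Nat.div_div_eq_div_mul, List.length_cons, pow_succ])
          (by simp only [List.length_cons, pow_succ]; nlinarith)
          (by rcases h3 with h3 | h3
              · simp at h3
              · right; simpa using h3)
        rw [show i + (l'.length + 1) = i + 1 + l'.length by ring]
        exact this
  -- `|l|` steps are enough, since `|l| < b ^ |l|`.
  obtain ⟨h1, h2, h3⟩ := key l (l, []) 0 (by simp) (by simp) (Or.inr rfl)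
  refine ⟨?_, h2⟩
  have hpos : 0 < b := by omega
  change _ < b ^ (l.foldl (fun (s : List Unit × List Unit) _ =>
    bif s.1.isEmpty then s else (q s.1, () :: s.2)) (l, [])).2.length
  rcases h3 with h3 | h3
  · rw [h3, List.length_nil] at h1
    have := Nat.div_eq_zero_iff.1 h1.symm
    rcases this with h | h
    · exact absurd h (by positivity)
    · exact h
  · rw [h3, zero_add]
    exact Nat.lt_pow_self (by omega)

/-- Multiplication of a number in unary by a constant. -/
def scale : ℕ → List Unit → List Unit
  | 0, _ => []
  | c + 1, l => l ++ scale c l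

@[simp] theorem length_scale (c : ℕ) (l : List Unit) : (scale c l).length = c * l.length := by
  induction c with
  | zero => simp [scale]
  | succ c ih => simp [scale, ih]; ring

/-- Comparison of numbers in unary. -/
def unaryLe (a b : List Unit) : Bool := (b.foldl (fun r _ => r.tail) a).isEmpty

theorem unaryLe_iff (a b : List Unit) : unaryLe a b = true ↔ a.length ≤ b.length := by
  unfold unaryLe
  induction b generalizing a with
  | nil => simp
  | cons c b ih => rw [List.foldl_cons, ih]; simp

/-- Equality of lists of bits. -/
def bitsEq (l l' : List Bool) : Bool :=
  let s := l.foldl (fun (s : Bool × List Bool) b =>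
    (s.1 && !s.2.isEmpty && s.2.headD false == b, s.2.tail)) (true, l')
  s.1 && s.2.isEmpty

theorem bitsEq_iff (l l' : List Bool) : bitsEq l l' = true ↔ l = l' := by
  have key : ∀ (l l' : List Bool) (ok : Bool),
      let s := l.foldl (fun (s : Bool × List Bool) b =>
        (s.1 && !s.2.isEmpty && s.2.headD false == b, s.2.tail)) (ok, l')
      (s.1 && s.2.isEmpty) = true ↔ ok = true ∧ l = l' := by
    intro l
    induction l with
    | nil => intro l' ok; cases l' <;> simp
    | cons b l ih =>
      intro l' ok
      rw [List.foldl_cons]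
      refine (ih _ _).trans ?_
      cases l' with
      | nil => simp
      | cons b' l' => simp; tauto
  simpa [bitsEq] using key l l' true

namespace PolyTime

variable {α β : Type*} [HasData α] [HasData β]

theorem halve {f : α → List Unit} (hf : PolyTime f) : PolyTime (fun a => halve (f a)) := by
  have := foldl_of_add (g := fun _ : α => (false, ([] : List Unit)))
    (f := fun z : α × (Bool × List Unit) × Unit =>
      bif z.2.1.1 then (false, () :: z.2.1.2) else (true, z.2.1.2))
    (const _) hf (id.snd.fst.fst.cond ((const _).prod ((const _).cons id.snd.fst.snd))
      ((const _).prod id.snd.fst.snd)) ⟨4, by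
      rintro x ⟨b, l⟩ a -
      have h1 : dsize false = 1 := rfl
      have h2 : dsize true = 3 := rfl
      cases b
      all_goals simp [h1, h2]
      all_goals omega⟩
  exact this.snd

theorem digitCount {q : List Unit → List Unit} (hq : PolyTime q)
    (hq' : ∀ l, (q l).length ≤ l.length) {f : α → List Unit} (hf : PolyTime f) :
    PolyTime (fun a => digitCount q (f a)) := by
  have := foldl_of_add (g := fun a : α => (f a, ([] : List Unit)))
    (f := fun z : α × (List Unit × List Unit) × Unit =>
      bif z.2.1.1.isEmpty then z.2.1 else (q z.2.1.1, () :: z.2.1.2))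
    (hf.prod (const _)) hf (id.snd.fst.fst.isEmpty.cond id.snd.fst
      ((hq.comp id.snd.fst.fst).prod ((const _).cons id.snd.fst.snd))) ⟨Polynomial.C 2, by
      rintro x ⟨l, l'⟩ a -
      have h1 := hq' l
      cases l
      all_goals simp at *
      all_goals omega⟩
  exact this.snd

theorem scale (c : ℕ) {f : α → List Unit} (hf : PolyTime f) :
    PolyTime (fun a => scale c (f a)) := by
  induction c with
  | zero => exact const _
  | succ c ih => exact hf.append ih

theorem unaryLe {f g : α → List Unit} (hf : PolyTime f) (hg : PolyTime g) :
    PolyTime (fun a => unaryLe (f a) (g a)) := by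
  have := foldl_of_add (f := fun z : α × List Unit × Unit => z.2.1.tail) hf hg id.snd.fst.tail
    ⟨0, fun x b a _ => by simp⟩
  exact this.isEmpty

theorem bitsEq {f g : α → List Bool} (hf : PolyTime f) (hg : PolyTime g) :
    PolyTime (fun a => bitsEq (f a) (g a)) := by
  have := foldl_of_add (g := fun a : α => (true, g a))
    (f := fun z : α × (Bool × List Bool) × Bool =>
      (z.2.1.1 && !z.2.1.2.isEmpty && z.2.1.2.headD false == z.2.2, z.2.1.2.tail))
    ((const _).prod hg) hf (((id.snd.fst.fst.and id.snd.fst.snd.isEmpty.not).and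
      ((id.snd.fst.snd.headD rfl).beq id.snd.snd)).prod id.snd.fst.snd.tail) ⟨Polynomial.C 3, by
      rintro x ⟨b, l⟩ a -
      have h1 := dsize_tail_le l
      have h2 := dsize_bool_le (b && !l.isEmpty && l.headD false == a)
      simp only [dsize_prod, Polynomial.eval_C]
      omega⟩
  exact this.fst.and this.snd.isEmpty

theorem bits {f : α → ℕ} (hf : PolyTime f) : PolyTime (fun a => (f a).bits) := hf

theorem all {h : α → List β} {f : α × β → Bool} (hh : PolyTime h) (hf : PolyTime f) :
    PolyTime (fun x => (h x).all (fun a => f (x, a))) := by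
  have := foldl_of_add (g := fun _ : α => true)
    (f := fun z : α × Bool × β => z.2.1 && f (z.1, z.2.2))
    (const _) hh (id.snd.fst.and (hf.comp (id.fst.prod id.snd.snd))) ⟨Polynomial.C 3, by
      rintro x b a -
      have h2 := dsize_bool_le (b && f (x, a))
      simp only [Polynomial.eval_C]
      omega⟩
  refine this.congr fun x => ?_
  have key : ∀ (l : List β) (b : Bool), l.foldl (fun b a => b && f (x, a)) b =
      (b && l.all (fun a => f (x, a))) := by
    intro l
    induction l with
    | nil => simp
    | cons a l ih => intro b; rw [List.foldl_cons, ih]; simp [Bool.and_assoc]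
  simpa using key (h x) true

theorem flatten {f : α → List (List β)} (hf : PolyTime f) : PolyTime (fun a => (f a).flatten) := by
  have := foldl_of_add (g := fun _ : α => ([] : List β))
    (f := fun z : α × List β × List β => z.2.2 ++ z.2.1)
    (const _) hf.reverse (id.snd.snd.append id.snd.fst) (by
      obtain ⟨p, hp⟩ := hf.dsize_le
      refine ⟨p, fun x b a ha => ?_⟩
      have h1 := dsize_le_of_mem (List.mem_reverse.1 ha)
      have h2 := hp x
      have h3 := dsize_append_le a b
      simp only
      omega)
  refine this.congr fun a => ?_
  simp [List.foldl_reverse]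
  induction f a with
  | nil => rfl
  | cons b l ih => simp [ih]

end PolyTime

theorem Nat.bits_two_pow (m : ℕ) : (2 ^ m).bits = List.replicate m false ++ [true] := by
  induction m with
  | zero => simp
  | succ m ih =>
    have : 2 ^ (m + 1) = 2 * 2 ^ m := by ring
    rw [this, Nat.bit0_bits _ (by positivity), ih, List.replicate_succ, List.cons_append]

/-- The binary expansion of a power of two is written down from its exponent. -/
theorem PolyTime.two_pow (B : ℕ) : PolyTime (fun e : List Unit => 2 ^ (e.length + B)) := by
  have h1 : PolyTime (fun e : List Unit =>
      e.map (fun _ => false) ++ (2 ^ B).bits) :=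
    (PolyTime.map (f := fun _ : List Unit × Unit => false) PolyTime.id (PolyTime.const _)).append
      (PolyTime.const _)
  refine Computes.congr h1 fun e => ?_
  change toData _ = toData (2 ^ (e.length + B)).bits
  simp only [Nat.bits_two_pow, List.replicate_add, List.append_assoc, List.map_const']

theorem PolyTime.div_two_pow {A j : ℕ} (hj : j ≤ A) :
    PolyTime (fun e : List Unit => (j : ℚ) / 2 ^ (e.length + A)) := by
  rcases Nat.eq_zero_or_pos j with rfl | hpos
  · simpa using PolyTime.const (α := List Unit) (0 : ℚ)
  obtain ⟨v, o, ho, rfl⟩ := Nat.exists_eq_two_pow_mul_odd hpos.ne'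
  -- The denominator in lowest terms is `2 ^ (e + (A - v))`, without truncation in `A - v`.
  have hv : v ≤ A := by
    have h1 : v < 2 ^ v := Nat.lt_two_pow_self
    have h2 : 2 ^ v ≤ 2 ^ v * o := Nat.le_mul_of_pos_right _ ho.pos
    omega
  refine Computes.congr ((Computes.const _ (Data.ofInt (o : ℤ))).pair
    (PolyTime.two_pow (A - v))) fun e => ?_
  have h1 : ((2 ^ v * o : ℕ) : ℚ) / 2 ^ (e.length + A) =
      ((o : ℤ) : ℚ) / ((2 ^ (e.length + (A - v)) : ℤ) : ℚ) := by
    have : e.length + A = e.length + (A - v) + v := by omega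
    rw [this, pow_add _ _ v]
    push_cast
    field_simp
  have hc : Nat.Coprime (o : ℤ).natAbs ((2 : ℤ) ^ (e.length + (A - v))).natAbs := by
    rw [Int.natAbs_pow, Int.natAbs_natCast]
    exact Nat.Coprime.pow_right _ (Nat.coprime_two_right.2 ho)
  have hp : (0 : ℤ) < 2 ^ (e.length + (A - v)) := by positivity
  have hn := Rat.num_div_eq_of_coprime hp hc
  have hd := Rat.den_div_eq_of_coprime hp hc
  rw [← h1] at hn hd
  change _ = Data.pair (Data.ofInt _) (Data.ofNat _)
  rw [hn]
  have hd' : (((2 ^ v * o : ℕ) : ℚ) / 2 ^ (e.length + A)).den = 2 ^ (e.length + (A - v)) := by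
    exact_mod_cast hd
  rw [hd']
  rfl

/-- Division of a number in unary, cut off at `z`, by `2 ^ (e + A)`: the numerator takes finitely
many values, so the result in lowest terms is read off from a table. -/
theorem PolyTime.min_div_two_pow {A z : ℕ} (hz : z ≤ A) :
    PolyTime (fun x : List Unit × List Unit =>
      ((min x.1.length z : ℕ) : ℚ) / 2 ^ (x.2.length + A)) := by
  have key : ∀ r j : ℕ, j + r ≤ A → PolyTime (fun x : List Unit × List Unit =>
      ((min x.1.length r + j : ℕ) : ℚ) / 2 ^ (x.2.length + A)) := by
    intro r
    induction r with
    | zero => intro j hj; simpa using (PolyTime.div_two_pow hj).comp PolyTime.id.snd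
    | succ r ih =>
      intro j hj
      refine (PolyTime.id.fst.isEmpty.cond
        ((PolyTime.div_two_pow (show j ≤ A by omega)).comp PolyTime.id.snd)
        ((ih (j + 1) (by omega)).comp (PolyTime.id.fst.tail.prod PolyTime.id.snd))).congr ?_
      rintro ⟨l, e⟩
      cases l with
      | nil => simp
      | cons a l =>
        simp only [List.isEmpty_cons, cond_false, List.tail_cons, List.length_cons]
        rw [Nat.add_min_add_right, show min l.length r + (j + 1) = min l.length r + 1 + j by ring]
  simpa using key z 0 (by omega)

/-! ### The dimension and the list of all words -/

/-- One more than the number of binary digits of the length of `l`, in unary: the least `ℓ` with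
`2 ^ ℓ > 2 |l|` if `l` is not empty. -/
def doubleLog {α : Type*} (l : List α) : List Unit :=
  () :: digitCount halve (l.map fun _ => ())

/-- The number of digits of `doubleLog l` in base `4`, in unary. -/
def sideLog {α : Type*} (l : List α) : List Unit :=
  digitCount (fun t => halve (halve t)) (doubleLog l)

/-- The dimension `4 ^ (e + A + 1)` in unary, where `e` is the length of `sideLog l`. -/
def dimension {α : Type*} (A : ℕ) (l : List α) : List Unit :=
  (List.replicate (A + 1) () ++ sideLog l).foldl (fun t _ => t ++ (t ++ (t ++ t))) [()]

theorem length_foldl_quadruple (l t : List Unit) :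
    (l.foldl (fun t _ => t ++ (t ++ (t ++ t))) t).length = 4 ^ l.length * t.length := by
  induction l generalizing t with
  | nil => simp
  | cons a l ih => rw [List.foldl_cons, ih]; simp; ring

theorem length_dimension {α : Type*} (A : ℕ) (l : List α) :
    (dimension A l).length = 4 ^ ((sideLog l).length + A + 1) := by
  rw [dimension, length_foldl_quadruple]
  simp
  ring

section estimates

variable {α : Type*} (A : ℕ) (l : List α)

theorem two_mul_length_le : 2 * l.length ≤ 2 ^ (doubleLog l).length := by
  have := (digitCount_spec le_rfl length_halve (l.map fun _ => ())).1
  simp only [List.length_map] at this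
  rw [doubleLog, List.length_cons, pow_succ]
  omega

theorem two_pow_doubleLog_le : 2 ^ (doubleLog l).length ≤ 4 * l.length + 2 := by
  have := (digitCount_spec le_rfl length_halve (l.map fun _ => ())).2
  simp only [List.length_map] at this
  rw [doubleLog, List.length_cons, pow_succ]
  omega

theorem sideLog_spec : (doubleLog l).length < 4 ^ (sideLog l).length ∧
    4 ^ (sideLog l).length ≤ 4 * (doubleLog l).length + 1 :=
  digitCount_spec (by norm_num)
    (fun l => by simp [Nat.div_div_eq_div_mul]) _

theorem doubleLog_le_dimension : 4 ^ (A + 1) * (doubleLog l).length ≤ (dimension A l).length := by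
  rw [length_dimension, show (sideLog l).length + A + 1 = (A + 1) + (sideLog l).length by ring,
    pow_add 4 (A + 1)]
  exact Nat.mul_le_mul le_rfl (sideLog_spec l).1.le

theorem dimension_le : (dimension A l).length ≤ 5 * 4 ^ (A + 1) * (doubleLog l).length := by
  rw [length_dimension, show (sideLog l).length + A + 1 = (A + 1) + (sideLog l).length by ring,
    pow_add]
  have h1 := (sideLog_spec l).2
  have h2 : 1 ≤ (doubleLog l).length := by simp [doubleLog]
  calc 4 ^ (A + 1) * 4 ^ (sideLog l).length ≤ 4 ^ (A + 1) * (5 * (doubleLog l).length) :=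
        Nat.mul_le_mul le_rfl (by omega)
    _ = _ := by ring

theorem length_doubleLog_le : (doubleLog l).length ≤ 4 * l.length + 2 :=
  (Nat.lt_two_pow_self).le.trans (two_pow_doubleLog_le l)

theorem two_pow_dimension_le :
    2 ^ (dimension A l).length ≤ (4 * l.length + 2) ^ (5 * 4 ^ (A + 1)) := by
  calc 2 ^ (dimension A l).length ≤ 2 ^ ((doubleLog l).length * (5 * 4 ^ (A + 1))) :=
        Nat.pow_le_pow_right (by norm_num) ((dimension_le A l).trans_eq (by ring))
    _ = (2 ^ (doubleLog l).length) ^ (5 * 4 ^ (A + 1)) := by rw [pow_mul]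
    _ ≤ _ := Nat.pow_le_pow_left (two_pow_doubleLog_le l) _

end estimates

/-- All words over `Bool` whose length is the given number in unary. -/
def words (d : List Unit) : List (List Bool) :=
  d.foldl (fun W _ => W.map (fun w => false :: w) ++ W.map (fun w => true :: w)) [[]]

theorem mem_words_iff (d : List Unit) (w : List Bool) : w ∈ words d ↔ w.length = d.length := by
  have key : ∀ (d : List Unit) (W : List (List Bool)) (m : ℕ),
      (∀ w, w ∈ W ↔ w.length = m) → ∀ w,
      w ∈ d.foldl (fun W _ => W.map (fun w => false :: w) ++ W.map (fun w => true :: w)) W ↔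
        w.length = m + d.length := by
    intro d
    induction d with
    | nil => intro W m h w; simpa using h w
    | cons a d ih =>
      intro W m h w
      rw [List.foldl_cons, ih _ (m + 1) ?_ w, List.length_cons, add_assoc, add_comm 1]
      intro w
      cases w with
      | nil => simp
      | cons b w => cases b <;> simp [h]
  have := key d [[]] 0 (by simp) w
  simpa [words] using this

theorem length_words (d : List Unit) : (words d).length = 2 ^ d.length := by
  have key : ∀ (d : List Unit) (W : List (List Bool)),
      (d.foldl (fun W _ => W.map (fun w => false :: w) ++ W.map (fun w => true :: w)) W).length =
        2 ^ d.length * W.length := by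
    intro d
    induction d with
    | nil => simp
    | cons a d ih => intro W; rw [List.foldl_cons, ih]; simp; ring
  simpa [words] using key d [[]]

theorem nodup_words (d : List Unit) : (words d).Nodup := by
  have key : ∀ (d : List Unit) (W : List (List Bool)), W.Nodup →
      (d.foldl (fun W _ => W.map (fun w => false :: w) ++ W.map (fun w => true :: w)) W).Nodup := by
    intro d
    induction d with
    | nil => exact fun W h => h
    | cons a d ih =>
      intro W h
      refine ih _ (List.Nodup.append (h.map fun _ _ => by simp) (h.map fun _ _ => by simp) ?_)
      intro w
      simp only [List.mem_map]
      rintro ⟨w', -, rfl⟩ ⟨w'', -, h⟩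
      simp at h
  exact key d _ (by simp)

theorem dsize_word_le (w : List Bool) : dsize w ≤ 4 * w.length + 1 := by
  have := dsize_le_of_forall (l := w) (B := 3) fun b _ => dsize_bool_le b
  omega

theorem dsize_words_le (d : List Unit) :
    dsize (words d) ≤ 2 ^ d.length * (4 * d.length + 2) + 1 := by
  have := dsize_le_of_forall (l := words d) (B := 4 * d.length + 1) fun w hw => by
    have := dsize_word_le w
    rwa [(mem_words_iff d w).1 hw] at this
  rwa [length_words] at this

namespace PolyTime

variable {α β : Type*} [HasData α] [HasData β]

theorem doubleLog {f : α → List β} (hf : PolyTime f) : PolyTime (fun a => doubleLog (f a)) :=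
  (const _).cons ((id.halve).digitCount (fun l => by simp; omega)
    (hf.map (f := fun _ : α × β => ()) (const _)))

theorem sideLog {f : α → List β} (hf : PolyTime f) : PolyTime (fun a => sideLog (f a)) :=
  (id.halve.halve).digitCount (fun l => by simp; omega) hf.doubleLog

theorem dimension (A : ℕ) : PolyTime (fun l : List β => dimension A l) := by
  refine foldl (g := fun _ : List β => [()])
    (h := fun l : List β => List.replicate (A + 1) () ++ _root_.sideLog l)
    (f := fun z : List β × List Unit × Unit => z.2.1 ++ (z.2.1 ++ (z.2.1 ++ z.2.1))) (const _)
    ((const _).append id.sideLog)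
    (id.snd.fst.append (id.snd.fst.append (id.snd.fst.append id.snd.fst)))
    ⟨Polynomial.C (2 * (5 * 4 ^ (A + 1))) * (4 * Polynomial.X + 2) + 1, fun l p hp => ?_⟩
  rw [dsize_unary, length_foldl_quadruple]
  have h1 : 4 ^ p.length * [()].length ≤ (_root_.dimension A l).length := by
    rw [_root_.dimension, length_foldl_quadruple]
    exact Nat.mul_le_mul (Nat.pow_le_pow_right (by norm_num) hp.length_le) le_rfl
  have h2 := dimension_le A l
  have h3 := length_doubleLog_le l
  have h4 := length_lt_dsize l
  have h5 : 4 ^ p.length * [()].length ≤ 5 * 4 ^ (A + 1) * (4 * dsize l + 2) :=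
    h1.trans (h2.trans (Nat.mul_le_mul le_rfl (by omega)))
  simp only [Polynomial.eval_add, Polynomial.eval_mul, Polynomial.eval_C, Polynomial.eval_X,
    Polynomial.eval_ofNat, Polynomial.eval_one]
  linarith

theorem words_dimension (A : ℕ) : PolyTime (fun l : List β => words (_root_.dimension A l)) := by
  refine foldl (g := fun _ : List β => [([] : List Bool)]) (h := fun l => _root_.dimension A l)
    (f := fun z : List β × List (List Bool) × Unit =>
      z.2.1.map (fun w => false :: w) ++ z.2.1.map (fun w => true :: w)) (const _) (dimension A)
    ((map (f := fun z : (List β × List (List Bool) × Unit) × List Bool => false :: z.2)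
        id.snd.fst ((const _).cons id.snd)).append
      (map (f := fun z : (List β × List (List Bool) × Unit) × List Bool => true :: z.2)
        id.snd.fst ((const _).cons id.snd)))
    ⟨(4 * Polynomial.X + 2) ^ (5 * 4 ^ (A + 1)) *
      (4 * (Polynomial.C (5 * 4 ^ (A + 1)) * (4 * Polynomial.X + 2)) + 2) + 1, fun l p hp => ?_⟩
  refine (dsize_words_le p).trans ?_
  have h1 := hp.length_le
  have h2 := two_pow_dimension_le A l
  have h3 := length_lt_dsize l
  have h4 : (_root_.dimension A l).length ≤ 5 * 4 ^ (A + 1) * (4 * dsize l + 2) :=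
    (dimension_le A l).trans (Nat.mul_le_mul le_rfl ((length_doubleLog_le l).trans (by omega)))
  have h5 : 2 ^ p.length ≤ (4 * dsize l + 2) ^ (5 * 4 ^ (A + 1)) :=
    (Nat.pow_le_pow_right (by norm_num) h1).trans
      (h2.trans (Nat.pow_le_pow_left (by omega) _))
  simp only [Polynomial.eval_add, Polynomial.eval_mul, Polynomial.eval_C, Polynomial.eval_X,
    Polynomial.eval_ofNat, Polynomial.eval_one, Polynomial.eval_pow]
  exact Nat.add_le_add_right (Nat.mul_le_mul h5 (by omega)) 1

end PolyTime

/-! ### The greedy code and the point sets -/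

/-- The numbers, in unary, of places where two words agree and where they differ. -/
def compareWords (w s : List Bool) : List Unit × List Unit :=
  (w.foldl (fun (r : List Bool × List Unit × List Unit) b =>
    (r.1.tail, bif r.1.headD false == b then (() :: r.2.1, r.2.2) else (r.2.1, () :: r.2.2)))
    (s, [], [])).2

/-- The number `a` of agreements and the number `b` of differences of two words have ratio between
`c / (c + 1)` and `(c + 1) / c`: as sign vectors, the words are almost orthogonal. -/
def nearOrthogonal (c : ℕ) (w s : List Bool) : Bool :=
  unaryLe (scale c (compareWords w s).1) (scale (c + 1) (compareWords w s).2) &&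
    unaryLe (scale c (compareWords w s).2) (scale (c + 1) (compareWords w s).1)

/-- The words of a list that are almost orthogonal to all words chosen before. -/
def greedyCode (c : ℕ) (W : List (List Bool)) : List (List Bool) :=
  W.foldl (fun C w => bif C.all (fun s => nearOrthogonal c w s) then w :: C else C) []

/-- The code words are given out in order to the entries of a list of numbers, in which numbers may
be repeated. The table lists the pairs in reverse order. -/
def codeTable (l : List ℕ) (C : List (List Bool)) : List (ℕ × List Bool) :=
  (l.foldl (fun (s : List (List Bool) × List (ℕ × List Bool)) x =>
    (s.1.tail, (x, s.1.headD []) :: s.2)) (C, [])).2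

/-- The last word that the table gives to the number `x`. -/
def lookupWord (t : List (ℕ × List Bool)) (x : ℕ) : List Bool :=
  t.foldl (fun r p => bif bitsEq p.1.bits x.bits then p.2 else r) []

/-- Add the bits of a word to a list of counters in unary. -/
def addWord (c : List (List Unit)) (w : List Bool) : List (List Unit) :=
  (c.foldl (fun (s : List Bool × List (List Unit)) n =>
    (s.1.tail, (bif s.1.headD false then () :: n else n) :: s.2)) (w, [])).2.reverse

/-- The sum, in unary, of the words that belong to the members of `T`. -/
def sumWords (d : List Unit) (t : List (ℕ × List Bool)) (T : List ℕ) : List (List Unit) :=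
  T.foldl (fun c x => addWord c (lookupWord t x)) (d.map fun _ => [])

/-- The table of code words for the numbers that occur in a list. -/
def wordTable (A c : ℕ) (l : List ℕ) : List (ℕ × List Bool) :=
  codeTable l (greedyCode c (words (dimension A l)))

/-- The point that belongs to the set `T`: the sum of its code words, scaled by
`2 ^ (-(e + A))`, where `4 ^ (e + A + 1)` is the dimension. -/
def pointOf (z A c : ℕ) (l : List ℕ) (T : List ℕ) : List ℚ :=
  (sumWords (dimension A l) (wordTable A c l) T).map fun m =>
    ((min m.length z : ℕ) : ℚ) / 2 ^ ((sideLog l).length + A)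

/-- The reduction, from a universe, a number and a list of sets to a number and a list of
points. -/
def reduction (z A c : ℕ) (I : ℕ × ℕ × List (List ℕ)) : ℕ × List (List ℚ) :=
  (I.2.1, I.2.2.map fun T => pointOf z A c I.2.2.flatten T)

theorem foldl_addWord (c : List (List Unit)) (w : List Bool) (out : List (List Unit)) :
    (c.foldl (fun (s : List Bool × List (List Unit)) n =>
      (s.1.tail, (bif s.1.headD false then () :: n else n) :: s.2)) (w, out)).2.reverse =
    out.reverse ++ addWord c w := by
  unfold addWord
  induction c generalizing w out with
  | nil => simp
  | cons n c ih => rw [List.foldl_cons, ih, List.foldl_cons, ih _ [_]]; simp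

@[simp] theorem addWord_nil (w : List Bool) : addWord [] w = [] := rfl

@[simp] theorem addWord_cons (n : List Unit) (c : List (List Unit)) (w : List Bool) :
    addWord (n :: c) w = (bif w.headD false then () :: n else n) :: addWord c w.tail := by
  rw [addWord, List.foldl_cons, foldl_addWord]
  simp

@[simp] theorem length_addWord (c : List (List Unit)) (w : List Bool) :
    (addWord c w).length = c.length := by
  induction c generalizing w with
  | nil => rfl
  | cons n c ih => simp [ih]

theorem getD_addWord (c : List (List Unit)) (w : List Bool) {j : ℕ} (hj : j < c.length) :
    ((addWord c w).getD j []).length = (c.getD j []).length + (w.getD j false).toNat := by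
  induction c generalizing w j with
  | nil => simp at hj
  | cons n c ih =>
    cases j with
    | zero =>
      cases w with
      | nil => simp
      | cons b w => cases b <;> simp
    | succ j =>
      have := ih w.tail (j := j) (by simpa using hj)
      cases w <;> simpa using this

@[simp] theorem length_foldl_addWord (T : List ℕ) (f : ℕ → List Bool) (c : List (List Unit)) :
    (T.foldl (fun c x => addWord c (f x)) c).length = c.length := by
  induction T generalizing c with
  | nil => rfl
  | cons x T ih => rw [List.foldl_cons, ih, length_addWord]

theorem getD_foldl_addWord (T : List ℕ) (f : ℕ → List Bool) (c : List (List Unit)) {j : ℕ}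
    (hj : j < c.length) :
    ((T.foldl (fun c x => addWord c (f x)) c).getD j []).length =
      (c.getD j []).length + (T.map fun x => ((f x).getD j false).toNat).sum := by
  induction T generalizing c with
  | nil => simp
  | cons x T ih =>
    rw [List.foldl_cons, ih _ (by simpa using hj), getD_addWord _ _ hj]
    simp [add_assoc]

theorem length_sumWords (d : List Unit) (t : List (ℕ × List Bool)) (T : List ℕ) :
    (sumWords d t T).length = d.length := by
  simp [sumWords]

theorem getD_sumWords (d : List Unit) (t : List (ℕ × List Bool)) (T : List ℕ) {j : ℕ}
    (hj : j < d.length) : ((sumWords d t T).getD j []).length =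
      (T.map fun x => ((lookupWord t x).getD j false).toNat).sum := by
  rw [sumWords, getD_foldl_addWord _ _ _ (by simpa using hj)]
  simp [List.getD_eq_getElem?_getD]

theorem dsize_sumWords_le (d : List Unit) (t : List (ℕ × List Bool)) (T : List ℕ) :
    dsize (sumWords d t T) ≤ d.length * (2 * T.length + 2) + 1 := by
  have := dsize_le_of_forall (l := sumWords d t T) (B := 2 * T.length + 1) fun m hm => by
    obtain ⟨j, hj, rfl⟩ := List.getElem_of_mem hm
    have h1 := getD_sumWords d t T (length_sumWords d t T ▸ hj)
    rw [List.getD_eq_getElem _ _ hj] at h1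
    rw [dsize_unary, h1]
    have h2 := List.sum_le_card_nsmul (T.map fun x => ((lookupWord t x).getD j false).toNat) 1
      (by
        intro n hn
        obtain ⟨x, -, rfl⟩ := List.mem_map.1 hn
        exact Bool.toNat_le _)
    simp at h2
    simp
    omega
  rwa [length_sumWords] at this

namespace PolyTime

variable {α β : Type*} [HasData α] [HasData β]

theorem compareWords {f g : α → List Bool} (hf : PolyTime f) (hg : PolyTime g) :
    PolyTime (fun a => compareWords (f a) (g a)) := by
  have := foldl_of_add (g := fun a : α => (g a, ([] : List Unit), ([] : List Unit)))
    (f := fun z : α × (List Bool × List Unit × List Unit) × Bool =>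
      (z.2.1.1.tail, bif z.2.1.1.headD false == z.2.2 then (() :: z.2.1.2.1, z.2.1.2.2)
        else (z.2.1.2.1, () :: z.2.1.2.2)))
    (hg.prod (const _)) hf (id.snd.fst.fst.tail.prod
      (((id.snd.fst.fst.headD rfl).beq id.snd.snd).cond
        (((const _).cons id.snd.fst.snd.fst).prod id.snd.fst.snd.snd)
        (id.snd.fst.snd.fst.prod ((const _).cons id.snd.fst.snd.snd)))) ⟨Polynomial.C 2, by
      rintro x ⟨l, p, q⟩ b -
      have h1 := dsize_tail_le l
      cases l.headD false == b
      all_goals simp only [dsize_prod, cond_true, cond_false, dsize_cons, dsize_unit,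
        Polynomial.eval_C]
      all_goals omega⟩
  exact this.snd

theorem nearOrthogonal (c : ℕ) {f g : α → List Bool} (hf : PolyTime f) (hg : PolyTime g) :
    PolyTime (fun a => nearOrthogonal c (f a) (g a)) :=
  (((hf.compareWords hg).fst.scale c).unaryLe ((hf.compareWords hg).snd.scale (c + 1))).and
    (((hf.compareWords hg).snd.scale c).unaryLe ((hf.compareWords hg).fst.scale (c + 1)))

theorem greedyCode (c : ℕ) {f : α → List (List Bool)} (hf : PolyTime f) :
    PolyTime (fun a => greedyCode c (f a)) :=
  foldl_of_add (g := fun _ : α => ([] : List (List Bool)))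
    (f := fun z : α × List (List Bool) × List Bool =>
      bif z.2.1.all (fun s => _root_.nearOrthogonal c z.2.2 s) then z.2.2 :: z.2.1 else z.2.1)
    (const _) hf
    ((all (f := fun y : (α × List (List Bool) × List Bool) × List Bool =>
        _root_.nearOrthogonal c y.1.2.2 y.2) id.snd.fst
        (nearOrthogonal c id.fst.snd.snd id.snd)).cond (id.snd.snd.cons id.snd.fst) id.snd.fst)
    (by
      obtain ⟨p, hp⟩ := hf.dsize_le
      refine ⟨p + 1, fun x C w hw => ?_⟩
      have h1 := dsize_le_of_mem hw
      have h2 := hp x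
      dsimp only
      cases C.all (fun s => _root_.nearOrthogonal c w s)
      all_goals simp only [cond_true, cond_false, dsize_cons, Polynomial.eval_add,
        Polynomial.eval_one]
      all_goals omega)

theorem codeTable {f : α → List ℕ} {g : α → List (List Bool)} (hf : PolyTime f)
    (hg : PolyTime g) : PolyTime (fun a => codeTable (f a) (g a)) := by
  -- A code word moves from the first component of the state to the second one, so only the number
  -- that it is paired with adds to the size.
  have := foldl_of_add (g := fun a : α => (g a, ([] : List (ℕ × List Bool))))
    (f := fun z : α × (List (List Bool) × List (ℕ × List Bool)) × ℕ =>
      (z.2.1.1.tail, (z.2.2, z.2.1.1.headD []) :: z.2.1.2))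
    (hg.prod (const _)) hf (id.snd.fst.fst.tail.prod
      ((id.snd.snd.prod (id.snd.fst.fst.headD rfl)).cons id.snd.fst.snd)) (by
      obtain ⟨p, hp⟩ := hf.dsize_le
      refine ⟨p + 3, ?_⟩
      rintro x ⟨C, t⟩ a ha
      have h1 := dsize_le_of_mem ha
      have h2 := hp x
      cases C
      all_goals simp only [dsize_prod, List.tail_nil, List.tail_cons, List.headD_nil,
        List.headD_cons, dsize_nil, dsize_cons, Polynomial.eval_add, Polynomial.eval_ofNat]
      all_goals omega)
  exact this.snd

theorem lookupWord {f : α → List (ℕ × List Bool)} {g : α → ℕ} (hf : PolyTime f)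
    (hg : PolyTime g) : PolyTime (fun a => lookupWord (f a) (g a)) :=
  foldl_of_add (g := fun _ : α => ([] : List Bool))
    (f := fun z : α × List Bool × ℕ × List Bool =>
      bif _root_.bitsEq z.2.2.1.bits (g z.1).bits then z.2.2.2 else z.2.1)
    (const _) hf
    ((id.snd.snd.fst.bits.bitsEq (hg.comp id.fst).bits).cond id.snd.snd.snd id.snd.fst) (by
      obtain ⟨p, hp⟩ := hf.dsize_le
      refine ⟨p, ?_⟩
      rintro x r a ha
      have h1 := dsize_le_of_mem ha
      have h2 := hp x
      dsimp only
      cases _root_.bitsEq a.1.bits (g x).bits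
      all_goals simp only [cond_true, cond_false, dsize_prod] at *
      all_goals omega)

theorem addWord {f : α → List (List Unit)} {g : α → List Bool} (hf : PolyTime f)
    (hg : PolyTime g) : PolyTime (fun a => addWord (f a) (g a)) := by
  have := foldl_of_add (g := fun a : α => (g a, ([] : List (List Unit))))
    (f := fun z : α × (List Bool × List (List Unit)) × List Unit =>
      (z.2.1.1.tail, (bif z.2.1.1.headD false then () :: z.2.2 else z.2.2) :: z.2.1.2))
    (hg.prod (const _)) hf (id.snd.fst.fst.tail.prod
      (((id.snd.fst.fst.headD rfl).cond ((const _).cons id.snd.snd) id.snd.snd).cons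
        id.snd.fst.snd)) (by
      obtain ⟨p, hp⟩ := hf.dsize_le
      refine ⟨p + 3, ?_⟩
      rintro x ⟨w, t⟩ a ha
      have h1 := dsize_le_of_mem ha
      have h2 := hp x
      have h3 := dsize_tail_le w
      dsimp only
      cases w.headD false
      all_goals simp only [cond_true, cond_false, dsize_prod, dsize_cons, dsize_unit,
        Polynomial.eval_add, Polynomial.eval_ofNat] at *
      all_goals omega)
  exact this.snd.reverse

theorem sumWords {f : α → List Unit} {g : α → List (ℕ × List Bool)} {h : α → List ℕ}
    (hf : PolyTime f) (hg : PolyTime g) (hh : PolyTime h) :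
    PolyTime (fun a => sumWords (f a) (g a) (h a)) :=
  foldl (g := fun a : α => (f a).map fun _ => ([] : List Unit))
    (f := fun z : α × List (List Unit) × ℕ =>
      _root_.addWord z.2.1 (_root_.lookupWord (g z.1) z.2.2))
    (hf.map (f := fun _ : α × Unit => ([] : List Unit)) (const _)) hh
    (id.snd.fst.addWord ((hg.comp id.fst).lookupWord id.snd.snd)) (by
      obtain ⟨p, hp⟩ := hf.dsize_le
      obtain ⟨q, hq⟩ := hh.dsize_le
      refine ⟨p * (2 * q + 2) + 1, fun x T hT => ?_⟩
      refine (dsize_sumWords_le (f x) (g x) T).trans ?_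
      have h1 := length_lt_dsize (f x)
      have h2 := hp x
      have h3 := hT.length_le
      have h4 := length_lt_dsize (h x)
      have h5 := hq x
      simp only [Polynomial.eval_add, Polynomial.eval_mul, Polynomial.eval_one,
        Polynomial.eval_ofNat]
      exact Nat.add_le_add_right (Nat.mul_le_mul (by omega) (by omega)) 1)

theorem wordTable (A c : ℕ) : PolyTime (fun l : List ℕ => wordTable A c l) :=
  id.codeTable ((words_dimension A).greedyCode c)

theorem pointOf {z A : ℕ} (hz : z ≤ A) (c : ℕ) :
    PolyTime (fun x : List ℕ × List ℕ => pointOf z A c x.1 x.2) := by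
  have h₁ : PolyTime (fun x : List ℕ × List ℕ =>
      _root_.sumWords (_root_.dimension A x.1) (_root_.wordTable A c x.1) x.2) :=
    ((dimension A).comp id.fst).sumWords ((wordTable A c).comp id.fst) id.snd
  have h₂ : PolyTime (fun y : (List ℕ × List ℕ) × List Unit =>
      (y.2, _root_.sideLog y.1.1)) := id.snd.prod id.fst.fst.sideLog
  exact (map h₁ ((min_div_two_pow hz).comp h₂)).congr fun x => by
    simp only [_root_.pointOf]

theorem reduction {z A : ℕ} (hz : z ≤ A) (c : ℕ) : PolyTime (reduction z A c) := by
  have h₁ : PolyTime (fun y : (ℕ × ℕ × List (List ℕ)) × List ℕ =>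
      (y.1.2.2.flatten, y.2)) := id.fst.snd.snd.flatten.prod id.snd
  have h₂ : PolyTime (fun I : ℕ × ℕ × List (List ℕ) => I.2.2) := id.snd.snd
  exact (id.snd.fst.prod (map h₂ ((pointOf hz c).comp h₁))).congr fun I => by
    simp only [_root_.reduction]

end PolyTime

/-! ### Almost orthogonal words -/

/-- Bits as signs. -/
def bitSign (b : Bool) : ℝ := if b then 1 else -1

theorem bitSign_eq (b : Bool) : bitSign b = 2 * (b.toNat : ℝ) - 1 := by
  cases b <;> norm_num [bitSign]

theorem bitSign_mul_self (b : Bool) : bitSign b * bitSign b = 1 := by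
  cases b <;> norm_num [bitSign]

/-- The inner product of two words as sign vectors. -/
def correlation : List Bool → List Bool → ℝ
  | b :: w, b' :: s => bitSign b * bitSign b' + correlation w s
  | _, _ => 0

theorem correlation_eq_sum (w s : List Bool) (h : w.length = s.length) :
    correlation w s =
      ∑ j : Fin w.length, bitSign (w.getD j false) * bitSign (s.getD j false) := by
  induction w generalizing s with
  | nil => simp [correlation]
  | cons b w ih =>
    cases s with
    | nil => simp at h
    | cons b' s =>
      have h' : w.length = s.length := by simpa using h
      change _ = ∑ j : Fin (w.length + 1), _
      rw [correlation, ih s h', Fin.sum_univ_succ]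
      simp

theorem correlation_self (w : List Bool) : correlation w w = w.length := by
  rw [correlation_eq_sum w w rfl]
  simp [bitSign_mul_self]

theorem correlation_comm (w s : List Bool) : correlation w s = correlation s w := by
  induction w generalizing s with
  | nil => cases s <;> rfl
  | cons b w ih =>
    cases s with
    | nil => rfl
    | cons b' s => simp only [correlation, ih s, mul_comm]

theorem compareWords_spec (w s : List Bool) (h : w.length = s.length) :
    correlation w s = (compareWords w s).1.length - (compareWords w s).2.length ∧
      (compareWords w s).1.length + (compareWords w s).2.length = w.length := by
  have key : ∀ (w s : List Bool) (p q : List Unit), w.length = s.length →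
      let r := (w.foldl (fun (r : List Bool × List Unit × List Unit) b =>
        (r.1.tail, bif r.1.headD false == b then (() :: r.2.1, r.2.2) else (r.2.1, () :: r.2.2)))
        (s, p, q)).2
      correlation w s + p.length - q.length = r.1.length - r.2.length ∧
        r.1.length + r.2.length = w.length + p.length + q.length := by
    intro w
    induction w with
    | nil => intro s p q _; simp [correlation]
    | cons b w ih =>
      intro s p q h
      cases s with
      | nil => simp at h
      | cons b' s =>
        have h' : w.length = s.length := by simpa using h
        rw [List.foldl_cons]
        by_cases hb : b' = b
        · have := ih s (() :: p) q h'
          simp only [List.tail_cons, List.headD_cons, hb, beq_self_eq_true, cond_true]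
          refine ⟨this.1 ▸ ?_, this.2.trans ?_⟩
          · simp [correlation, bitSign_mul_self]; ring
          · simp only [List.length_cons]; omega
        · have := ih s p (() :: q) h'
          have hne : (b' == b) = false := by simpa using hb
          simp only [List.tail_cons, List.headD_cons, hne, cond_false]
          refine ⟨this.1 ▸ ?_, this.2.trans ?_⟩
          · have : bitSign b * bitSign b' = -1 := by
              cases b <;> cases b' <;> simp_all [bitSign]
            simp [correlation, this]; ring
          · simp only [List.length_cons]; omega
  simpa [compareWords] using key w s [] [] h

theorem nearOrthogonal_iff (c : ℕ) (w s : List Bool) : nearOrthogonal c w s = true ↔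
    c * (compareWords w s).1.length ≤ (c + 1) * (compareWords w s).2.length ∧
      c * (compareWords w s).2.length ≤ (c + 1) * (compareWords w s).1.length := by
  simp [nearOrthogonal, unaryLe_iff]

theorem abs_correlation_le {c : ℕ} {w s : List Bool} (h : w.length = s.length)
    (hn : nearOrthogonal c w s = true) : c * |correlation w s| ≤ w.length := by
  obtain ⟨h1, h2⟩ := (nearOrthogonal_iff c w s).1 hn
  obtain ⟨h3, h4⟩ := compareWords_spec w s h
  rw [h3, ← h4]
  push_cast
  have h1' : (c : ℝ) * (compareWords w s).1.length ≤ (c + 1) * (compareWords w s).2.length := by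
    exact_mod_cast h1
  have h2' : (c : ℝ) * (compareWords w s).2.length ≤ (c + 1) * (compareWords w s).1.length := by
    exact_mod_cast h2
  have ha : (0 : ℝ) ≤ (compareWords w s).1.length := by positivity
  have hb : (0 : ℝ) ≤ (compareWords w s).2.length := by positivity
  rcases abs_cases ((compareWords w s).1.length - (compareWords w s).2.length : ℝ) with h | h
  · rw [h.1]; linarith
  · rw [h.1]; linarith

theorem lt_abs_correlation {c : ℕ} {w s : List Bool} (h : w.length = s.length)
    (hn : nearOrthogonal c w s = false) : w.length < (2 * c + 1) * |correlation w s| := by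
  obtain ⟨h3, h4⟩ := compareWords_spec w s h
  rw [h3, ← h4]
  have hn' : ¬ (nearOrthogonal c w s = true) := by simp [hn]
  rw [nearOrthogonal_iff, not_and_or, not_le, not_le] at hn'
  push_cast
  rcases hn' with hn' | hn'
  · have h1 : ((c : ℝ) + 1) * (compareWords w s).2.length < c * (compareWords w s).1.length := by
      exact_mod_cast hn'
    have h5 := mul_le_mul_of_nonneg_left
      (le_abs_self ((compareWords w s).1.length - (compareWords w s).2.length : ℝ))
      (show (0 : ℝ) ≤ 2 * c + 1 by positivity)
    linarith
  · have h1 : ((c : ℝ) + 1) * (compareWords w s).1.length < c * (compareWords w s).2.length := by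
      exact_mod_cast hn'
    have h5 := mul_le_mul_of_nonneg_left
      (neg_le_abs ((compareWords w s).1.length - (compareWords w s).2.length : ℝ))
      (show (0 : ℝ) ≤ 2 * c + 1 by positivity)
    linarith

theorem words_cons (u : Unit) (d : List Unit) : words (u :: d) =
    (words d).map (fun w => false :: w) ++ (words d).map (fun w => true :: w) := by
  have key : ∀ (d : List Unit) (W : List (List Bool)),
      d.foldl (fun W _ => W.map (fun w => false :: w) ++ W.map (fun w => true :: w)) W =
        (fun W => W.map (fun w => false :: w) ++ W.map (fun w => true :: w))^[d.length] W := by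
    intro d
    induction d with
    | nil => exact fun _ => rfl
    | cons a d ih => intro W; rw [List.foldl_cons, ih]; rfl
  rw [words, words, key, key, List.length_cons, Function.iterate_succ_apply']

/-- The moment generating function of the inner product with a random word. -/
theorem sum_exp_correlation (r : ℝ) (d : List Unit) (s : List Bool) (h : s.length = d.length) :
    ((words d).map fun w => Real.exp (r * correlation w s)).sum = (2 * Real.cosh r) ^ d.length := by
  induction d generalizing s with
  | nil => simp [words, correlation]
  | cons u d ih =>
    cases s with
    | nil => simp at h
    | cons b s =>
      have ih' := ih s (by simpa using h)
      have h1 : ∀ b' : Bool,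
          ((words d).map fun w => Real.exp (r * correlation (b' :: w) (b :: s))).sum =
            Real.exp (r * (bitSign b' * bitSign b)) * (2 * Real.cosh r) ^ d.length := by
        intro b'
        rw [← ih', ← List.sum_map_mul_left]
        simp only [correlation, mul_add, Real.exp_add]
      rw [words_cons, List.map_append, List.sum_append, List.map_map, List.map_map]
      have h2 := h1 false
      have h3 := h1 true
      simp only [Function.comp_def]
      rw [h2, h3, List.length_cons, pow_succ', Real.cosh_eq]
      cases b <;> simp [bitSign] <;> ring

/-- The rate at which the proportion of words far from orthogonal to a given one decays with the
dimension. -/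
noncomputable def decayRate (c : ℕ) : ℝ := Real.exp (-(1 / (2 * (2 * c + 1) ^ 2)))

/-- Chernoff's bound: few words are far from orthogonal to a given one. -/
theorem card_not_nearOrthogonal_le (c : ℕ) (d : List Unit) (s : List Bool)
    (h : s.length = d.length) :
    (((words d).toFinset.filter fun w => nearOrthogonal c w s = false).card : ℝ) ≤
      2 * 2 ^ d.length * decayRate c ^ d.length := by
  set r : ℝ := 1 / (2 * c + 1) with hr
  have hc : (0 : ℝ) < 2 * c + 1 := by positivity
  have hr0 : 0 < r := by positivity
  have hpt : ∀ w ∈ (words d).toFinset.filter fun w => nearOrthogonal c w s = false,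
      (1 : ℝ) ≤ Real.exp (-(r ^ 2 * d.length)) *
        (Real.exp (r * correlation w s) + Real.exp ((-r) * correlation w s)) := by
    intro w hw
    rw [Finset.mem_filter, List.mem_toFinset, mem_words_iff] at hw
    have h1 := lt_abs_correlation (hw.1.trans h.symm) hw.2
    have h2 : r ^ 2 * d.length ≤ r * |correlation w s| := by
      rw [← hw.1, sq, mul_assoc]
      refine mul_le_mul_of_nonneg_left ?_ hr0.le
      rw [hr, one_div, inv_mul_le_iff₀ hc]
      exact h1.le
    have h3 : Real.exp (r * |correlation w s|) ≤
        Real.exp (r * correlation w s) + Real.exp ((-r) * correlation w s) := by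
      rcases abs_cases (correlation w s) with h | h
      · rw [h.1]; linarith [Real.exp_pos ((-r) * correlation w s)]
      · rw [h.1, show r * -correlation w s = (-r) * correlation w s by ring]
        linarith [Real.exp_pos (r * correlation w s)]
    calc (1 : ℝ) ≤ Real.exp (-(r ^ 2 * d.length) + r * |correlation w s|) :=
          Real.one_le_exp (by linarith)
      _ = Real.exp (-(r ^ 2 * d.length)) * Real.exp (r * |correlation w s|) := Real.exp_add _ _
      _ ≤ _ := mul_le_mul_of_nonneg_left h3 (Real.exp_pos _).le
  have hsum : ∀ r : ℝ, ∑ w ∈ (words d).toFinset, Real.exp (r * correlation w s) =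
      (2 * Real.cosh r) ^ d.length := by
    intro r
    rw [List.sum_toFinset _ (nodup_words d), sum_exp_correlation r d s h]
  calc (((words d).toFinset.filter fun w => nearOrthogonal c w s = false).card : ℝ)
      = ∑ w ∈ (words d).toFinset.filter fun w => nearOrthogonal c w s = false, (1 : ℝ) := by simp
    _ ≤ ∑ w ∈ (words d).toFinset.filter fun w => nearOrthogonal c w s = false,
        Real.exp (-(r ^ 2 * d.length)) *
          (Real.exp (r * correlation w s) + Real.exp ((-r) * correlation w s)) :=
        Finset.sum_le_sum hpt
    _ ≤ ∑ w ∈ (words d).toFinset, Real.exp (-(r ^ 2 * d.length)) *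
          (Real.exp (r * correlation w s) + Real.exp ((-r) * correlation w s)) :=
        Finset.sum_le_sum_of_subset_of_nonneg (Finset.filter_subset _ _)
          (fun _ _ _ => by positivity)
    _ = Real.exp (-(r ^ 2 * d.length)) * (2 * (2 * Real.cosh r) ^ d.length) := by
        rw [← Finset.mul_sum, Finset.sum_add_distrib, hsum, hsum, Real.cosh_neg]
        ring
    _ ≤ Real.exp (-(r ^ 2 * d.length)) * (2 * (2 * Real.exp (r ^ 2 / 2)) ^ d.length) := by
        have := Real.cosh_le_exp_half_sq r
        have := (Real.cosh_pos r).le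
        gcongr
    _ = 2 * 2 ^ d.length * decayRate c ^ d.length := by
        rw [decayRate, mul_pow, ← Real.exp_nat_mul, ← Real.exp_nat_mul]
        have : Real.exp (d.length * -(1 / (2 * (2 * (c : ℝ) + 1) ^ 2))) =
            Real.exp (-(r ^ 2 * d.length)) * Real.exp (d.length * (r ^ 2 / 2)) := by
          rw [← Real.exp_add, hr]
          congr 1
          field_simp
          ring
        rw [this]
        ring

theorem greedyCode_spec (c : ℕ) (W : List (List Bool)) :
    (∀ w ∈ greedyCode c W, w ∈ W) ∧
    (greedyCode c W).Pairwise (fun w s => nearOrthogonal c w s = true) ∧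
    ∀ w ∈ W, w ∈ greedyCode c W ∨ ∃ s ∈ greedyCode c W, nearOrthogonal c w s = false := by
  have key : ∀ (W C : List (List Bool)),
      C.Pairwise (fun w s => nearOrthogonal c w s = true) →
      let C' := W.foldl (fun C w => bif C.all (fun s => nearOrthogonal c w s) then w :: C else C) C
      (∀ w ∈ C', w ∈ C ∨ w ∈ W) ∧ C'.Pairwise (fun w s => nearOrthogonal c w s = true) ∧
      (∀ w ∈ C, w ∈ C') ∧ ∀ w ∈ W, w ∈ C' ∨ ∃ s ∈ C', nearOrthogonal c w s = false := by
    intro W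
    induction W with
    | nil => intro C hC; simp [hC]
    | cons v W ih =>
      intro C hC
      rw [List.foldl_cons]
      cases hv : C.all (fun s => nearOrthogonal c v s) with
      | false =>
        obtain ⟨h1, h2, h3, h4⟩ := ih C hC
        simp only [cond_false]
        refine ⟨fun w hw => (h1 w hw).imp_right (List.mem_cons_of_mem _), h2, h3, ?_⟩
        intro w hw
        rcases List.mem_cons.1 hw with rfl | hw
        · obtain ⟨s, hs, hs'⟩ := List.all_eq_false.1 hv
          exact Or.inr ⟨s, h3 s hs, by simpa using hs'⟩
        · exact h4 w hw
      | true =>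
        obtain ⟨h1, h2, h3, h4⟩ := ih (v :: C)
          (List.pairwise_cons.2 ⟨fun s hs => List.all_eq_true.1 hv s hs, hC⟩)
        simp only [cond_true]
        refine ⟨fun w hw => ?_, h2, fun w hw => h3 w (List.mem_cons_of_mem _ hw), ?_⟩
        · rcases h1 w hw with h | h
          · rcases List.mem_cons.1 h with rfl | h
            · exact Or.inr List.mem_cons_self
            · exact Or.inl h
          · exact Or.inr (List.mem_cons_of_mem _ h)
        · intro w hw
          rcases List.mem_cons.1 hw with rfl | hw
          · exact Or.inl (h3 _ List.mem_cons_self)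
          · exact h4 w hw
  obtain ⟨h1, h2, -, h4⟩ := key W [] List.Pairwise.nil
  exact ⟨fun w hw => (h1 w hw).resolve_left (by simp), h2, h4⟩

/-- The greedy code is maximal, so the sets of words that its members exclude cover everything,
and it has to be large. -/
theorem one_le_length_greedyCode {c : ℕ} (hc : 1 ≤ c) (d : List Unit) (hd : d ≠ []) :
    1 ≤ (greedyCode c (words d)).length * (2 * decayRate c ^ d.length) := by
  obtain ⟨h1, -, h3⟩ := greedyCode_spec c (words d)
  set C := greedyCode c (words d)
  have hself : ∀ w ∈ words d, nearOrthogonal c w w = false := by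
    intro w hw
    by_contra h
    have h4 := abs_correlation_le (c := c) rfl (by simpa using h)
    obtain ⟨h5, h6⟩ := compareWords_spec w w rfl
    have h7 := ((nearOrthogonal_iff c w w).1 (by simpa using h)).1
    rw [correlation_self] at h5
    have h8 : 0 < w.length := by
      rw [(mem_words_iff d w).1 hw]
      exact List.length_pos_iff.2 hd
    have h9 : (compareWords w w).1.length = w.length + (compareWords w w).2.length := by
      have : ((compareWords w w).1.length : ℝ) = w.length + (compareWords w w).2.length := by
        linarith
      exact_mod_cast this
    nlinarith
  have hcover : (words d).toFinset ⊆ C.toFinset.biUnion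
      fun s => (words d).toFinset.filter fun w => nearOrthogonal c w s = false := by
    intro w hw
    have hw' := List.mem_toFinset.1 hw
    obtain ⟨s, hs, hws⟩ : ∃ s ∈ C, nearOrthogonal c w s = false := by
      rcases h3 w hw' with h | h
      · exact ⟨w, h, hself w hw'⟩
      · exact h
    exact Finset.mem_biUnion.2 ⟨s, List.mem_toFinset.2 hs, Finset.mem_filter.2 ⟨hw, hws⟩⟩
  have hcard : (2 : ℝ) ^ d.length ≤
      C.length * (2 * 2 ^ d.length * decayRate c ^ d.length) := by
    calc (2 : ℝ) ^ d.length = ((words d).toFinset.card : ℝ) := by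
          rw [List.toFinset_card_of_nodup (nodup_words d), length_words]; simp
      _ ≤ ∑ s ∈ C.toFinset,
          (((words d).toFinset.filter fun w => nearOrthogonal c w s = false).card : ℝ) := by
          exact_mod_cast (Finset.card_le_card hcover).trans Finset.card_biUnion_le
      _ ≤ ∑ s ∈ C.toFinset, (2 * 2 ^ d.length * decayRate c ^ d.length) := by
          refine Finset.sum_le_sum fun s hs => card_not_nearOrthogonal_le c d s ?_
          exact (mem_words_iff d s).1 (h1 s (List.mem_toFinset.1 hs))
      _ ≤ _ := by
          rw [Finset.sum_const, nsmul_eq_mul]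
          have : 0 ≤ decayRate c := (Real.exp_pos _).le
          gcongr
          exact List.toFinset_card_le C
  have h2 : (0 : ℝ) < 2 ^ d.length := by positivity
  nlinarith

theorem codeTable_cons (x : ℕ) (l : List ℕ) (C : List (List Bool)) :
    codeTable (x :: l) C = codeTable l C.tail ++ [(x, C.headD [])] := by
  have key : ∀ (l : List ℕ) (C : List (List Bool)) (t : List (ℕ × List Bool)),
      (l.foldl (fun (s : List (List Bool) × List (ℕ × List Bool)) x =>
        (s.1.tail, (x, s.1.headD []) :: s.2)) (C, t)).2 = codeTable l C ++ t := by
    intro l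
    induction l with
    | nil => intro C t; rfl
    | cons y l ih =>
      intro C t
      rw [codeTable, List.foldl_cons, ih, List.foldl_cons, ih _ [_]]
      simp
  rw [codeTable, List.foldl_cons, key]

/-- A number is given the code word at the position of its first occurrence. -/
theorem lookupWord_codeTable (l : List ℕ) (C : List (List Bool)) {x : ℕ} (hx : x ∈ l) :
    lookupWord (codeTable l C) x = C.getD (l.idxOf x) [] := by
  induction l generalizing C with
  | nil => simp at hx
  | cons y l ih =>
    rw [codeTable_cons, lookupWord, List.foldl_append]
    change (bif bitsEq y.bits x.bits then C.headD [] else lookupWord (codeTable l C.tail) x) = _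
    by_cases hxy : y = x
    · subst hxy
      rw [(bitsEq_iff _ _).2 rfl, List.idxOf_cons_self]
      cases C <;> rfl
    · have hne : bitsEq y.bits x.bits = false := by
        rw [← Bool.not_eq_true, bitsEq_iff]
        intro h
        apply hxy
        rw [← Nat.digits_inj_iff (b := 2), Nat.digits_two_eq_bits, Nat.digits_two_eq_bits, h]
      rw [hne, cond_false, ih _ ((List.mem_cons.1 hx).resolve_left (Ne.symm hxy)),
        List.idxOf_cons_ne _ hxy]
      cases C <;> simp

/-- In dimension at least `4 ^ (A + 1) ℓ`, a word excludes at most a proportion `2 ^ (1 - ℓ)` of all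
words. -/
theorem exists_dimension_offset (c : ℕ) : ∃ A₀ : ℕ, ∀ A ≥ A₀,
    decayRate c ^ 4 ^ (A + 1) ≤ 1 / 2 := by
  have h0 : 0 ≤ decayRate c := (Real.exp_pos _).le
  have h1 : decayRate c < 1 := by
    rw [decayRate, Real.exp_lt_one_iff]
    have : (0 : ℝ) < 1 / (2 * (2 * c + 1) ^ 2) := by positivity
    linarith
  obtain ⟨m, hm⟩ := exists_pow_lt_of_lt_one (show (0 : ℝ) < 1 / 2 by norm_num) h1
  refine ⟨m, fun A hA => (pow_le_pow_of_le_one h0 h1.le ?_).trans hm.le⟩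
  have : A + 1 < 4 ^ (A + 1) := Nat.lt_pow_self (by norm_num)
  omega

theorem length_le_length_greedyCode {A c : ℕ} (hc : 1 ≤ c)
    (hA : decayRate c ^ 4 ^ (A + 1) ≤ 1 / 2) (l : List ℕ) :
    l.length ≤ (greedyCode c (words (dimension A l))).length := by
  have h0 : 0 ≤ decayRate c := (Real.exp_pos _).le
  have h1 : decayRate c ≤ 1 := by
    rw [decayRate, Real.exp_le_one_iff]
    have : (0 : ℝ) ≤ 1 / (2 * (2 * c + 1) ^ 2) := by positivity
    linarith
  have hd : dimension A l ≠ [] := by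
    rw [← List.length_pos_iff, length_dimension]
    positivity
  have h2 := one_le_length_greedyCode hc _ hd
  set C := greedyCode c (words (dimension A l))
  have h3 : decayRate c ^ (dimension A l).length ≤ (1 / 2) ^ (doubleLog l).length := by
    calc decayRate c ^ (dimension A l).length
        ≤ decayRate c ^ (4 ^ (A + 1) * (doubleLog l).length) :=
          pow_le_pow_of_le_one h0 h1 (doubleLog_le_dimension A l)
      _ = (decayRate c ^ 4 ^ (A + 1)) ^ (doubleLog l).length := pow_mul _ _ _
      _ ≤ _ := pow_le_pow_left₀ (pow_nonneg h0 _) hA _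
  have h4 : (2 * l.length : ℝ) ≤ 2 ^ (doubleLog l).length := by
    exact_mod_cast two_mul_length_le l
  have h5 : (1 : ℝ) ≤ C.length * (2 * (1 / 2) ^ (doubleLog l).length) :=
    h2.trans (by gcongr)
  have h6 : (2 : ℝ) ^ (doubleLog l).length * (1 / 2) ^ (doubleLog l).length = 1 := by
    rw [← mul_pow]; norm_num
  have h7 : (0 : ℝ) < 2 ^ (doubleLog l).length := by positivity
  have h8 : (2 : ℝ) ^ (doubleLog l).length ≤ 2 * C.length := by
    have := mul_le_mul_of_nonneg_left h5 h7.le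
    calc (2 : ℝ) ^ (doubleLog l).length
        ≤ 2 ^ (doubleLog l).length * (C.length * (2 * (1 / 2) ^ (doubleLog l).length)) := by
          linarith
      _ = 2 * C.length * (2 ^ (doubleLog l).length * (1 / 2) ^ (doubleLog l).length) := by ring
      _ = _ := by rw [h6, mul_one]
  have h9 : (l.length : ℝ) ≤ C.length := by linarith
  exact_mod_cast h9

/-- The words given out to the members of a list have the right length, and different members
get almost orthogonal words. -/
theorem lookupWord_wordTable {A c : ℕ} (hc : 1 ≤ c)
    (hA : decayRate c ^ 4 ^ (A + 1) ≤ 1 / 2) (l : List ℕ) :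
    (∀ x ∈ l, (lookupWord (wordTable A c l) x).length = (dimension A l).length) ∧
    ∀ x ∈ l, ∀ y ∈ l, x ≠ y →
      c * |correlation (lookupWord (wordTable A c l) x) (lookupWord (wordTable A c l) y)| ≤
        (dimension A l).length := by
  obtain ⟨h1, h2, -⟩ := greedyCode_spec c (words (dimension A l))
  have hlen := length_le_length_greedyCode hc hA l
  set C := greedyCode c (words (dimension A l)) with hC
  have hlook : ∀ x ∈ l, ∃ h : l.idxOf x < C.length,
      lookupWord (wordTable A c l) x = C[l.idxOf x] := by
    intro x hx
    have h : l.idxOf x < C.length := (List.idxOf_lt_length_iff.2 hx).trans_le hlen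
    exact ⟨h, by rw [wordTable, lookupWord_codeTable l _ hx, List.getD_eq_getElem _ _ h]⟩
  have hword : ∀ x ∈ l,
      (lookupWord (wordTable A c l) x).length = (dimension A l).length := by
    intro x hx
    obtain ⟨h, hx'⟩ := hlook x hx
    rw [hx']
    exact (mem_words_iff _ _).1 (h1 _ (List.getElem_mem h))
  refine ⟨hword, ?_⟩
  have hlt : ∀ x ∈ l, ∀ y ∈ l, l.idxOf x < l.idxOf y →
      c * |correlation (lookupWord (wordTable A c l) x) (lookupWord (wordTable A c l) y)| ≤
        (dimension A l).length := by
    intro x hx y hy hxy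
    obtain ⟨h, hx'⟩ := hlook x hx
    obtain ⟨h', hy'⟩ := hlook y hy
    have h3 := List.pairwise_iff_getElem.1 h2 _ _ h h' hxy
    rw [← hx', ← hy'] at h3
    exact (abs_correlation_le ((hword x hx).trans (hword y hy).symm) h3).trans_eq
      (by rw [hword x hx])
  intro x hx y hy hxy
  rcases lt_trichotomy (l.idxOf x) (l.idxOf y) with h | h | h
  · exact hlt x hx y hy h
  · exact absurd ((List.idxOf_inj hx).1 h) hxy
  · rw [correlation_comm]
    exact hlt y hy x hx h

/-! ### Intersections in dense families of sets -/

section families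

variable {n z y : ℕ} {𝒞 : Finset (Finset (Fin n))}

/-- The sum of the sizes of all pairwise intersections is at most what it would be if they all had
`y - 1` elements, up to the number of common `y`-subsets. -/
theorem sum_card_inter_le (hy : 1 ≤ y) :
    ∑ T ∈ 𝒞, ∑ T' ∈ 𝒞, ((T ∩ T').card : ℝ) ≤
      (y - 1) * (𝒞.card : ℝ) ^ 2 +
        ∑ S ∈ Finset.powersetCard y Finset.univ, ((cov S 𝒞).card : ℝ) ^ 2 := by
  have hchoose : ∀ t : ℕ, t + 1 ≤ y + t.choose y := by
    intro t
    induction t with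
    | zero => omega
    | succ t ih =>
      rcases Nat.lt_or_ge t (y - 1) with h | h
      · omega
      · obtain ⟨y', rfl⟩ : ∃ y', y = y' + 1 := ⟨y - 1, by omega⟩
        rw [Nat.choose_succ_succ']
        have := Nat.choose_pos (n := t) (k := y') (by omega)
        omega
  have hcount : ∑ T ∈ 𝒞, ∑ T' ∈ 𝒞, ((T ∩ T').card.choose y : ℝ) =
      ∑ S ∈ Finset.powersetCard y Finset.univ, ((cov S 𝒞).card : ℝ) ^ 2 := by
    have h1 : ∀ T T' : Finset (Fin n), ((T ∩ T').card.choose y : ℝ) =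
        ∑ S ∈ Finset.powersetCard y Finset.univ,
          (if S ⊆ T then (1 : ℝ) else 0) * (if S ⊆ T' then 1 else 0) := by
      intro T T'
      have h2 : ∀ S : Finset (Fin n), (if S ⊆ T then (1 : ℝ) else 0) * (if S ⊆ T' then 1 else 0) =
          if S ⊆ T ∩ T' then 1 else 0 := by
        intro S
        by_cases h : S ⊆ T <;> by_cases h' : S ⊆ T' <;> simp [Finset.subset_inter_iff, h, h']
      simp only [h2]
      rw [Finset.sum_boole, ← Finset.card_powersetCard]
      congr 2
      ext S
      simp [Finset.mem_powersetCard]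
      tauto
    simp only [h1]
    rw [Finset.sum_congr rfl fun T _ => Finset.sum_comm, Finset.sum_comm]
    refine Finset.sum_congr rfl fun S _ => ?_
    simp only [← Finset.mul_sum, ← Finset.sum_mul]
    rw [sq, cov, Finset.card_filter]
    push_cast
    rfl
  rw [← hcount]
  have h2 : ∀ T ∈ 𝒞, ∀ T' ∈ 𝒞, ((T ∩ T').card : ℝ) ≤
      ((y : ℝ) - 1) + ((T ∩ T').card.choose y : ℝ) := by
    intro T _ T' _
    have := hchoose (T ∩ T').card
    have h : (((T ∩ T').card + 1 : ℕ) : ℝ) ≤ ((y + (T ∩ T').card.choose y : ℕ) : ℝ) := by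
      exact_mod_cast this
    push_cast at h
    linarith
  calc _ ≤ ∑ T ∈ 𝒞, ∑ T' ∈ 𝒞, (((y : ℝ) - 1) + ((T ∩ T').card.choose y : ℝ)) :=
        Finset.sum_le_sum fun T hT => Finset.sum_le_sum fun T' hT' => h2 T hT T' hT'
    _ = _ := by
        simp only [Finset.sum_add_distrib, Finset.sum_const, nsmul_eq_mul]
        ring

/-- Few `z`-sets contain a given set with more than `y` elements. -/
theorem card_cov_le (h𝒞 : ∀ T ∈ 𝒞, T.card = z) {R : Finset (Fin n)} (hR : y + 1 ≤ R.card)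
    (hn : 1 ≤ n) : (cov R 𝒞).card ≤ n ^ (z - y - 1) := by
  have h1 : (cov R 𝒞).card ≤
      (Finset.powersetCard (z - R.card) (Finset.univ : Finset (Fin n))).card := by
    refine Finset.card_le_card_of_injOn (fun T => T \ R) ?_ ?_
    · intro T hT
      have hT := Finset.mem_filter.1 hT
      refine Finset.mem_coe.2 (Finset.mem_powersetCard.2 ?_)
      exact ⟨Finset.subset_univ _, by rw [Finset.card_sdiff_of_subset hT.2, h𝒞 T hT.1]⟩
    · intro T hT T' hT' h
      have hT := (Finset.mem_filter.1 hT).2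
      have hT' := (Finset.mem_filter.1 hT').2
      dsimp only at h
      rw [← Finset.sdiff_union_of_subset hT, h, Finset.sdiff_union_of_subset hT']
  rw [Finset.card_powersetCard, Finset.card_univ, Fintype.card_fin] at h1
  exact h1.trans ((Nat.choose_le_pow _ _).trans (Nat.pow_le_pow_right hn (by omega)))

/-- If every `y`-set is covered at most `B` times, the squares of the numbers of covered sets sum
up to at most `B |𝒞|`, up to a term of lower order: by Cauchy–Schwarz, the square of the sum counts
triples `(T, S, S')` with `S, S' ⊆ T`, and those with `S ≠ S'` contain the union `S ∪ S'` of more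
than `y` elements. -/
theorem sum_sq_card_cov_le (h𝒞 : ∀ T ∈ 𝒞, T.card = z) (hn : 1 ≤ n) {B : ℝ}
    (hB : ∀ S : Finset (Fin n), S.card = y → ((cov S 𝒞).card : ℝ) ≤ B) :
    (∑ S ∈ Finset.powersetCard y Finset.univ, ((cov S 𝒞).card : ℝ) ^ 2) ^ 2 ≤
      𝒞.card * (B * (∑ S ∈ Finset.powersetCard y Finset.univ, ((cov S 𝒞).card : ℝ) ^ 2) +
        n ^ (z - y - 1) * (z.choose y * 𝒞.card) ^ 2) := by
  set Y := Finset.powersetCard y (Finset.univ : Finset (Fin n)) with hY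
  set F : Finset (Fin n) → ℝ := fun S => ((cov S 𝒞).card : ℝ) with hF
  have hF0 : ∀ S, 0 ≤ F S := fun S => Nat.cast_nonneg _
  have hFsum : ∀ S, F S = ∑ T ∈ 𝒞, if S ⊆ T then (1 : ℝ) else 0 := by
    intro S
    simp only [hF, cov, Finset.sum_boole]
  -- Double counting of the pairs `S ⊆ T`.
  have hdouble : ∀ g : Finset (Fin n) → ℝ, ∑ S ∈ Y, F S * g S =
      ∑ T ∈ 𝒞, ∑ S ∈ Y, (if S ⊆ T then 1 else 0) * g S := by
    intro g
    rw [Finset.sum_comm]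
    refine Finset.sum_congr rfl fun S _ => ?_
    rw [← Finset.sum_mul, hFsum]
  have htotal : ∑ S ∈ Y, F S = z.choose y * 𝒞.card := by
    have h1 := hdouble fun _ => 1
    simp only [mul_one] at h1
    rw [h1, Finset.sum_congr rfl (g := fun _ => (z.choose y : ℝ)), Finset.sum_const, nsmul_eq_mul,
      mul_comm]
    intro T hT
    rw [← Finset.sum_filter, Finset.sum_const, nsmul_eq_mul, mul_one, ← h𝒞 T hT,
      ← Finset.card_powersetCard]
    congr 2
    ext S
    simp [hY, Finset.mem_powersetCard]
    tauto
  have hpair : ∀ S ∈ Y, ∀ S' ∈ Y,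
      F (S ∪ S') ≤ (if S = S' then F S else 0) + n ^ (z - y - 1) := by
    intro S hS S' hS'
    have h1 := (Finset.mem_powersetCard.1 hS).2
    have h2 := (Finset.mem_powersetCard.1 hS').2
    by_cases h : S = S'
    · subst h
      simp
    · rw [if_neg h, zero_add]
      have h3 : y + 1 ≤ (S ∪ S').card := by
        by_contra hlt
        have h4 : S = S ∪ S' := Finset.eq_of_subset_of_card_le Finset.subset_union_left (by omega)
        have h5 : S' = S ∪ S' :=
          Finset.eq_of_subset_of_card_le Finset.subset_union_right (by omega)
        exact h (h4.trans h5.symm)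
      have h4 := card_cov_le h𝒞 h3 hn
      simp only [hF]
      exact_mod_cast h4
  have hsq : ∑ S ∈ Y, F S ^ 2 = ∑ T ∈ 𝒞, ∑ S ∈ Y, (if S ⊆ T then 1 else 0) * F S := by
    rw [← hdouble F]
    simp only [sq]
  have hcs : (∑ S ∈ Y, F S ^ 2) ^ 2 ≤
      𝒞.card * ∑ T ∈ 𝒞, (∑ S ∈ Y, (if S ⊆ T then 1 else 0) * F S) ^ 2 := by
    rw [hsq]
    exact sq_sum_le_card_mul_sum_sq
  refine hcs.trans (mul_le_mul_of_nonneg_left ?_ (Nat.cast_nonneg _))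
  calc ∑ T ∈ 𝒞, (∑ S ∈ Y, (if S ⊆ T then 1 else 0) * F S) ^ 2
      = ∑ S ∈ Y, ∑ S' ∈ Y, F S * F S' * F (S ∪ S') := by
        have h1 : ∀ T, (∑ S ∈ Y, (if S ⊆ T then (1 : ℝ) else 0) * F S) ^ 2 =
            ∑ S ∈ Y, ∑ S' ∈ Y, F S * F S' * (if S ∪ S' ⊆ T then 1 else 0) := by
          intro T
          rw [sq, Finset.sum_mul_sum]
          refine Finset.sum_congr rfl fun S _ => Finset.sum_congr rfl fun S' _ => ?_
          by_cases h : S ⊆ T <;> by_cases h' : S' ⊆ T <;> simp [Finset.union_subset_iff, h, h']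
        simp only [h1]
        rw [Finset.sum_comm]
        refine Finset.sum_congr rfl fun S _ => ?_
        rw [Finset.sum_comm]
        refine Finset.sum_congr rfl fun S' _ => ?_
        rw [← Finset.mul_sum, hFsum (S ∪ S')]
    _ ≤ ∑ S ∈ Y, ∑ S' ∈ Y, F S * F S' * ((if S = S' then F S else 0) + n ^ (z - y - 1)) :=
        Finset.sum_le_sum fun S hS => Finset.sum_le_sum fun S' hS' =>
          mul_le_mul_of_nonneg_left (hpair S hS S' hS') (mul_nonneg (hF0 _) (hF0 _))
    _ = ∑ S ∈ Y, F S ^ 2 * F S + n ^ (z - y - 1) * (∑ S ∈ Y, F S) ^ 2 := by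
        rw [sq (∑ S ∈ Y, F S), Finset.sum_mul_sum, Finset.mul_sum, ← Finset.sum_add_distrib]
        refine Finset.sum_congr rfl fun S hS => ?_
        simp only [mul_add, Finset.sum_add_distrib, mul_ite, mul_zero, Finset.mul_sum]
        congr 1
        · rw [Finset.sum_ite_eq, if_pos hS]; ring
        · exact Finset.sum_congr rfl fun _ _ => by ring
    _ ≤ _ := by
        rw [htotal, Finset.mul_sum]
        refine add_le_add (Finset.sum_le_sum fun S hS => ?_) le_rfl
        rw [mul_comm]
        exact mul_le_mul_of_nonneg_right (hB S (Finset.mem_powersetCard.1 hS).2) (sq_nonneg _)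

/-- In a family of `z`-sets that is large compared with `n ^ (z - y - 1)` and in which every `y`-set
is covered by at most the proportion `β`, two random members have at most `y - 1 + β + η` elements
in common on average. -/
theorem sum_card_inter_le_of_large (hy : 1 ≤ y) (h𝒞 : ∀ T ∈ 𝒞, T.card = z) (hn : 1 ≤ n)
    {β η : ℝ} (hβ0 : 0 ≤ β) (hη : 0 < η)
    (hlarge : (z.choose y : ℝ) ^ 2 * n ^ (z - y - 1) ≤ η ^ 2 * 𝒞.card)
    (hβ : ∀ S : Finset (Fin n), S.card = y → ((cov S 𝒞).card : ℝ) ≤ β * 𝒞.card) :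
    ∑ T ∈ 𝒞, ∑ T' ∈ 𝒞, ((T ∩ T').card : ℝ) ≤ (y - 1 + β + η) * (𝒞.card : ℝ) ^ 2 := by
  have h1 := sum_card_inter_le (𝒞 := 𝒞) hy
  have h2 := sum_sq_card_cov_le h𝒞 hn hβ
  set X := ∑ S ∈ Finset.powersetCard y Finset.univ, ((cov S 𝒞).card : ℝ) ^ 2
  set m : ℝ := (𝒞.card : ℝ)
  have hm : 0 ≤ m := Nat.cast_nonneg _
  have h3 : X ^ 2 ≤ m ^ 2 * β * X + η ^ 2 * (m ^ 2) ^ 2 := by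
    calc X ^ 2 ≤ _ := h2
      _ = m ^ 2 * β * X + ((z.choose y : ℝ) ^ 2 * n ^ (z - y - 1)) * m ^ 3 := by ring
      _ ≤ m ^ 2 * β * X + (η ^ 2 * m) * m ^ 3 := by gcongr
      _ = _ := by ring
  have h4 : X ≤ (β + η) * m ^ 2 := by
    by_contra hlt
    rw [not_le] at hlt
    have hX : 0 ≤ X := Finset.sum_nonneg fun _ _ => sq_nonneg _
    rcases hm.eq_or_lt with hm0 | hm0
    · rw [← hm0] at h3 hlt
      nlinarith
    · have h5 : η * m ^ 2 < X - β * m ^ 2 := by linarith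
      have h6 : 0 < η * m ^ 2 := by positivity
      have h7 : 0 ≤ β * m ^ 2 := by positivity
      nlinarith
  nlinarith

end families

/-! ### Clusterings of points indexed by sets -/

section clustering

variable {d z y : ℕ} {I : CoverageInstance} {p : Finset (Fin I.n) → EuclideanSpace ℝ (Fin d)}
  {P : Finset (EuclideanSpace ℝ (Fin d))}

theorem card_eq_of_injOn (hp : Set.InjOn p I.E) (hP : ∀ x, x ∈ P ↔ ∃ T ∈ I.E, p T = x) :
    P.card = I.E.card := by
  classical
  have : P = I.E.image p := by ext x; simp [hP]
  rw [this, Finset.card_image_of_injOn hp]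

open Classical in
theorem minSumCost_image {k : ℕ} (hp : Set.InjOn p I.E) {D : Fin k → Finset (Finset (Fin I.n))}
    (hD : ∀ i, D i ⊆ I.E) :
    minSumCost (fun i => (D i).image p) =
      ∑ i, ∑ T ∈ D i, ∑ T' ∈ D i, ‖p T - p T'‖ ^ 2 := by
  unfold minSumCost
  refine Finset.sum_congr rfl fun i _ => ?_
  have hi : Set.InjOn p (D i) := hp.mono (hD i)
  rw [Finset.sum_image hi]
  refine Finset.sum_congr rfl fun T _ => ?_
  rw [Finset.sum_image hi]

theorem CoverageInstance.Complete.someCostAtMost {δ η : ℝ} (hI : I.Complete y δ) (hδ : 0 ≤ δ)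
    (hη : 0 ≤ η) (hyz : y ≤ z) (hp : Set.InjOn p I.E) (hP : ∀ x, x ∈ P ↔ ∃ T ∈ I.E, p T = x)
    (hup : ∀ T ∈ I.E, ∀ T' ∈ I.E,
      ‖p T - p T'‖ ^ 2 ≤ (1 + η) * (2 * ((z : ℝ) - (T ∩ T').card))) :
    SomeCostAtMost P I.k ((1 + 3 * δ) * ((z : ℝ) - y) * (2 * (1 + η))) := by
  classical
  obtain ⟨S, ψ, hS, hbal, hψ⟩ := hI
  -- The clusters are the fibres of `ψ`.
  let D : Fin I.k → Finset (Finset (Fin I.n)) := fun i =>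
    I.E.filter fun T => ∃ h : T ∈ I.E, ψ ⟨T, h⟩ = i
  have hDE : ∀ i, D i ⊆ I.E := fun i => Finset.filter_subset _ _
  have hDdisj : ∀ i j, i ≠ j → Disjoint (D i) (D j) := by
    intro i j hij
    rw [Finset.disjoint_left]
    intro T hT hT'
    obtain ⟨-, h, h1⟩ := Finset.mem_filter.1 hT
    obtain ⟨-, h', h2⟩ := Finset.mem_filter.1 hT'
    exact hij (h1.symm.trans h2)
  have hcard : ∀ i, ((D i).card : ℝ) ≤ (1 + δ) * (I.E.card / I.k) := by
    intro i
    have h1 := hbal i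
    have h2 : Nat.card {a // ψ a = i} = (D i).card := by
      rw [← Nat.card_eq_finsetCard]
      refine Nat.card_congr ⟨fun a => ⟨a.1.1, Finset.mem_filter.2 ⟨a.1.2, a.1.2, a.2⟩⟩,
        fun T => ⟨⟨T.1, (Finset.mem_filter.1 T.2).1⟩, ?_⟩, fun _ => rfl, fun _ => rfl⟩
      exact (Finset.mem_filter.1 T.2).2.2
    have h3 : Nat.card {T // T ∈ I.E} = I.E.card := Nat.card_eq_finsetCard _
    rw [h2, h3, Nat.card_fin] at h1
    exact h1
  have hsum : ∑ i, ((D i).card : ℝ) ≤ I.E.card := by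
    have h1 : (Finset.univ.biUnion D).card = ∑ i, (D i).card :=
      Finset.card_biUnion fun i _ j _ hij => hDdisj i j hij
    have h2 : (Finset.univ.biUnion D).card ≤ I.E.card :=
      Finset.card_le_card (Finset.biUnion_subset.2 fun i _ => hDE i)
    rw [h1] at h2
    exact_mod_cast h2
  have hzy : (0 : ℝ) ≤ (z : ℝ) - y := sub_nonneg.2 (by exact_mod_cast hyz)
  refine ⟨fun i => (D i).image p, ⟨fun i j hij => ?_, fun x => ?_⟩, ?_⟩
  · rw [Finset.disjoint_left]
    intro x hx hx'
    obtain ⟨T, hT, rfl⟩ := Finset.mem_image.1 hx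
    obtain ⟨T', hT', h⟩ := Finset.mem_image.1 hx'
    rw [hp (hDE j hT') (hDE i hT) h] at hT'
    exact Finset.disjoint_left.1 (hDdisj i j hij) hT hT'
  · rw [hP]
    constructor
    · rintro ⟨T, hT, rfl⟩
      exact ⟨ψ ⟨T, hT⟩, Finset.mem_image_of_mem _ (Finset.mem_filter.2 ⟨hT, hT, rfl⟩)⟩
    · rintro ⟨i, hx⟩
      obtain ⟨T, hT, rfl⟩ := Finset.mem_image.1 hx
      exact ⟨T, hDE i hT, rfl⟩
  rw [minSumCost_image hp hDE, card_eq_of_injOn hp hP]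
  have hpair : ∀ i, ∀ T ∈ D i, ∀ T' ∈ D i,
      ‖p T - p T'‖ ^ 2 ≤ (1 + η) * (2 * ((z : ℝ) - y)) := by
    intro i T hT T' hT'
    obtain ⟨hTE, h, h1⟩ := Finset.mem_filter.1 hT
    obtain ⟨hTE', h', h2⟩ := Finset.mem_filter.1 hT'
    refine (hup T hTE T' hTE').trans ?_
    have h3 : S i ⊆ T ∩ T' := by
      refine Finset.subset_inter ?_ ?_
      · rw [← h1]; exact hψ ⟨T, h⟩
      · rw [← h2]; exact hψ ⟨T', h'⟩
    have h4 : (y : ℝ) ≤ (T ∩ T').card := by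
      rw [← hS i]; exact_mod_cast Finset.card_le_card h3
    gcongr
  have hk : (0 : ℝ) ≤ I.E.card / I.k := by positivity
  calc ∑ i, ∑ T ∈ D i, ∑ T' ∈ D i, ‖p T - p T'‖ ^ 2
      ≤ ∑ i, ∑ T ∈ D i, ∑ T' ∈ D i, (1 + η) * (2 * ((z : ℝ) - y)) :=
        Finset.sum_le_sum fun i _ => Finset.sum_le_sum fun T hT => Finset.sum_le_sum fun T' hT' =>
          hpair i T hT T' hT'
    _ = (1 + η) * (2 * ((z : ℝ) - y)) * ∑ i, ((D i).card : ℝ) * (D i).card := by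
        simp only [Finset.sum_const, nsmul_eq_mul, Finset.mul_sum]
        exact Finset.sum_congr rfl fun _ _ => by ring
    _ ≤ (1 + η) * (2 * ((z : ℝ) - y)) *
        ∑ i, ((D i).card : ℝ) * ((1 + δ) * (I.E.card / I.k)) := by
        gcongr with i
        exact hcard i
    _ ≤ (1 + η) * (2 * ((z : ℝ) - y)) * (I.E.card * ((1 + δ) * (I.E.card / I.k))) := by
        rw [← Finset.sum_mul]
        gcongr
    _ ≤ (1 + η) * (2 * ((z : ℝ) - y)) * (I.E.card * ((1 + 3 * δ) * (I.E.card / I.k))) := by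
        gcongr
        linarith
    _ = _ := by ring

/-- The square root is concave: the lower bound for a cluster is linear in the proportion `β` that
its best `y`-set covers. -/
theorem le_sqrt_of_proportion {u β τ : ℝ} (hu : 1 ≤ u) (hβ : 0 ≤ β) (hβ' : β ≤ 1)
    (hτ : 0 ≤ τ) (hτ' : τ ≤ 1) :
    β * √u + (1 - β) * √(u + 1) - τ ≤ √(u + 1 - β - τ ^ 2) := by
  have h1 : β * √u + (1 - β) * √(u + 1) ≤ √(u + 1 - β) := by
    have h := Real.strictConcaveOn_sqrt.concaveOn.2 (show u ∈ Set.Ici (0 : ℝ) from by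
      simp; linarith) (show u + 1 ∈ Set.Ici (0 : ℝ) from by simp; linarith) hβ
      (show 0 ≤ 1 - β by linarith) (by ring)
    simp only [smul_eq_mul] at h
    rwa [show β * u + (1 - β) * (u + 1) = u + 1 - β by ring] at h
  have h2 : √(u + 1 - β) ≤ √(u + 1 - β - τ ^ 2) + τ := by
    refine Real.sqrt_le_iff.2 ⟨by positivity, ?_⟩
    have h3 : 0 ≤ u + 1 - β - τ ^ 2 := by nlinarith
    nlinarith [Real.sq_sqrt h3, Real.sqrt_nonneg (u + 1 - β - τ ^ 2)]
  linarith

/-- Clusters that are not large compared with `n ^ (z - y - 1)` make up a proportion of at most `κ`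
of all points. For the others, the average intersection is bounded through the best `y`-set, and
the bounds for the clusters are combined by Cauchy–Schwarz. -/
theorem CoverageInstance.Sound.everyCostAtLeast {α η τ κ : ℝ} {K : ℕ} (hI : I.Sound y α)
    (hdense : I.IsDense z y K) (hy : 1 ≤ y) (hyz : y < z) (hη : η < 1)
    (hτ : 0 < τ) (hτ' : τ ≤ 1)
    (hK : (z.choose y : ℝ) ^ 2 / τ ^ 4 ≤ κ * K)
    (hsmall : τ + √((z : ℝ) - y + 1) * κ ≤ α * √((z : ℝ) - y) + (1 - α) * √((z : ℝ) - y + 1))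
    (hp : Set.InjOn p I.E) (hP : ∀ x, x ∈ P ↔ ∃ T ∈ I.E, p T = x)
    (hlow : ∀ T ∈ I.E, ∀ T' ∈ I.E,
      (1 - η) * (2 * ((z : ℝ) - (T ∩ T').card)) ≤ ‖p T - p T'‖ ^ 2) :
    EveryCostAtLeast P I.k (2 * (1 - η) * (α * √((z : ℝ) - y) + (1 - α) * √((z : ℝ) - y + 1) -
      (τ + √((z : ℝ) - y + 1) * κ)) ^ 2) := by
  classical
  obtain ⟨hzn, hk1, hEz, hE⟩ := hdense
  have hn : 1 ≤ I.n := by omega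
  intro C hC
  set a := √((z : ℝ) - y) with ha
  set b := √((z : ℝ) - y + 1) with hb
  have hu : (1 : ℝ) ≤ (z : ℝ) - y := by
    have : (y : ℝ) + 1 ≤ z := by exact_mod_cast hyz
    linarith
  have hab : a ≤ b := Real.sqrt_le_sqrt (by linarith)
  have hb0 : 0 ≤ b := Real.sqrt_nonneg _
  have hk : (0 : ℝ) < I.k := by exact_mod_cast hk1
  set N : ℝ := (I.E.card : ℝ) with hN
  -- The clusters, as families of sets.
  let D : Fin I.k → Finset (Finset (Fin I.n)) := fun i => I.E.filter fun T => p T ∈ C i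
  have hDE : ∀ i, D i ⊆ I.E := fun i => Finset.filter_subset _ _
  have hCD : C = fun i => (D i).image p := by
    funext i
    ext x
    simp only [D, Finset.mem_image, Finset.mem_filter]
    constructor
    · intro hx
      obtain ⟨T, hT, rfl⟩ := (hP x).1 ((hC.2 x).2 ⟨i, hx⟩)
      exact ⟨T, ⟨hT, hx⟩, rfl⟩
    · rintro ⟨T, ⟨-, hT⟩, rfl⟩
      exact hT
  have hDdisj : ∀ i j, i ≠ j → Disjoint (D i) (D j) := by
    intro i j hij
    rw [Finset.disjoint_left]
    intro T hT hT'
    exact Finset.disjoint_left.1 (hC.1 i j hij) (Finset.mem_filter.1 hT).2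
      (Finset.mem_filter.1 hT').2
  have hDunion : Finset.univ.biUnion D = I.E := by
    ext T
    simp only [Finset.mem_biUnion, Finset.mem_univ, true_and]
    constructor
    · rintro ⟨i, hT⟩
      exact hDE i hT
    · intro hT
      obtain ⟨i, hi⟩ := (hC.2 (p T)).1 ((hP _).2 ⟨T, hT, rfl⟩)
      exact ⟨i, Finset.mem_filter.2 ⟨hT, hi⟩⟩
  have hsum : ∑ i, ((D i).card : ℝ) = N := by
    have h1 : (Finset.univ.biUnion D).card = ∑ i, (D i).card :=
      Finset.card_biUnion fun i _ j _ hij => hDdisj i j hij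
    rw [hDunion] at h1
    rw [hN, h1]
    push_cast
    rfl
  -- The `y`-set that covers most of a cluster.
  have hbest : ∀ i, ∃ S : Finset (Fin I.n), S.card = y ∧
      ∀ S' : Finset (Fin I.n), S'.card = y → (cov S' (D i)).card ≤ (cov S (D i)).card := by
    intro i
    obtain ⟨S, hS, hmax⟩ := Finset.exists_max_image
      (Finset.powersetCard y (Finset.univ : Finset (Fin I.n))) (fun S => (cov S (D i)).card)
      (Finset.powersetCard_nonempty.2 (by simp; omega))
    exact ⟨S, (Finset.mem_powersetCard.1 hS).2, fun S' hS' =>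
      hmax S' (Finset.mem_powersetCard.2 ⟨Finset.subset_univ _, hS'⟩)⟩
  choose S hS hSmax using hbest
  have hcov : ∑ i, ((cov (S i) (D i)).card : ℝ) ≤ α * N := by
    refine le_trans ?_ (hI S hS)
    have h1 : (Finset.univ.biUnion fun i => cov (S i) (D i)).card =
        ∑ i, (cov (S i) (D i)).card :=
      Finset.card_biUnion fun i _ j _ hij => Finset.disjoint_of_subset_left
        (Finset.filter_subset _ _) (Finset.disjoint_of_subset_right (Finset.filter_subset _ _)
          (hDdisj i j hij))
    rw [← Nat.cast_sum, ← h1]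
    exact_mod_cast Finset.card_le_card (Finset.biUnion_mono fun i _ =>
      Finset.filter_subset_filter _ (hDE i))
  set cost : Fin I.k → ℝ := fun i => ∑ T ∈ D i, ∑ T' ∈ D i, ‖p T - p T'‖ ^ 2 with hcost
  set M : ℝ := (z.choose y : ℝ) ^ 2 * (I.n : ℝ) ^ (z - y - 1) / τ ^ 4 with hM
  have hη' : 0 < 2 * (1 - η) := by linarith
  have hcluster : ∀ i, ((D i).card : ℝ) * (b - τ) - (b - a) * (cov (S i) (D i)).card - b * M ≤
      √(cost i / (2 * (1 - η))) := by
    intro i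
    set m : ℝ := ((D i).card : ℝ) with hm
    have hm0 : 0 ≤ m := Nat.cast_nonneg _
    have hM0 : 0 ≤ M := by positivity
    have hc0 : (0 : ℝ) ≤ (cov (S i) (D i)).card := Nat.cast_nonneg _
    have hcm : ((cov (S i) (D i)).card : ℝ) ≤ m := by
      have : (cov (S i) (D i)).card ≤ (D i).card :=
        Finset.card_le_card (Finset.filter_subset _ _)
      rw [hm]
      exact_mod_cast this
    rcases le_or_gt m M with h | h
    · -- A small cluster: the left-hand side is not positive.
      refine le_trans ?_ (Real.sqrt_nonneg _)
      nlinarith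
    · have hmpos : 0 < m := hM0.trans_lt h
      set β : ℝ := (cov (S i) (D i)).card / m with hβ
      have hβm : β * m = (cov (S i) (D i)).card := div_mul_cancel₀ _ hmpos.ne'
      have hβ0 : 0 ≤ β := div_nonneg hc0 hm0
      have hβ1 : β ≤ 1 := (div_le_one hmpos).2 hcm
      have h1 := sum_card_inter_le_of_large (𝒞 := D i) (z := z) (β := β) (η := τ ^ 2) hy
        (fun T hT => hEz T (hDE i hT)) hn hβ0 (by positivity) (by
          rw [hM, div_lt_iff₀ (by positivity)] at h
          rw [← pow_mul, ← hm]
          norm_num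
          linarith) (fun S' hS' => by
          rw [← hm, hβm]
          exact_mod_cast hSmax i S' hS')
      rw [← hm] at h1
      have h2 : m ^ 2 * ((z : ℝ) - y + 1 - β - τ ^ 2) ≤ cost i / (2 * (1 - η)) := by
        rw [le_div_iff₀ hη']
        calc m ^ 2 * ((z : ℝ) - y + 1 - β - τ ^ 2) * (2 * (1 - η))
            ≤ (z * m ^ 2 - ∑ T ∈ D i, ∑ T' ∈ D i, ((T ∩ T').card : ℝ)) * (2 * (1 - η)) := by
              refine mul_le_mul_of_nonneg_right ?_ hη'.le
              linarith
          _ = ∑ T ∈ D i, ∑ T' ∈ D i, (1 - η) * (2 * ((z : ℝ) - (T ∩ T').card)) := by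
              simp only [← Finset.mul_sum, Finset.sum_sub_distrib, Finset.sum_const, nsmul_eq_mul]
              rw [← hm]
              ring
          _ ≤ cost i := Finset.sum_le_sum fun T hT => Finset.sum_le_sum fun T' hT' =>
              hlow T (hDE i hT) T' (hDE i hT')
      have h3 := le_sqrt_of_proportion hu hβ0 hβ1 hτ.le hτ'
      calc m * (b - τ) - (b - a) * (cov (S i) (D i)).card - b * M
          ≤ m * (b - τ) - (b - a) * (cov (S i) (D i)).card := by nlinarith
        _ = m * (β * a + (1 - β) * b - τ) := by rw [← hβm]; ring
        _ ≤ m * √((z : ℝ) - y + 1 - β - τ ^ 2) := mul_le_mul_of_nonneg_left h3 hm0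
        _ = √(m ^ 2 * ((z : ℝ) - y + 1 - β - τ ^ 2)) := by
            rw [Real.sqrt_mul (sq_nonneg m), Real.sqrt_sq hm0]
        _ ≤ _ := Real.sqrt_le_sqrt h2
  have hkM : I.k * M ≤ κ * N := by
    have h1 : (K : ℝ) * (I.k * (I.n : ℝ) ^ (z - y - 1)) ≤ N := by
      rw [hN]
      exact_mod_cast hE
    have hκ : 0 ≤ κ := by
      by_contra hneg
      rw [not_le] at hneg
      have h2 : 0 < (z.choose y : ℝ) ^ 2 / τ ^ 4 := by
        have := Nat.choose_pos hyz.le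
        positivity
      have h3 : (0 : ℝ) ≤ K := Nat.cast_nonneg _
      nlinarith
    calc I.k * M = (z.choose y : ℝ) ^ 2 / τ ^ 4 * (I.k * (I.n : ℝ) ^ (z - y - 1)) := by
          rw [hM]; ring
      _ ≤ κ * K * (I.k * (I.n : ℝ) ^ (z - y - 1)) := by gcongr
      _ = κ * (K * (I.k * (I.n : ℝ) ^ (z - y - 1))) := by ring
      _ ≤ κ * N := by gcongr
  have htotal : N * (α * a + (1 - α) * b - (τ + b * κ)) ≤ ∑ i, √(cost i / (2 * (1 - η))) := by
    calc N * (α * a + (1 - α) * b - (τ + b * κ))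
        = N * (b - τ) - (b - a) * (α * N) - b * (κ * N) := by ring
      _ ≤ N * (b - τ) - (b - a) * (∑ i, ((cov (S i) (D i)).card : ℝ)) - b * (I.k * M) := by
          have h1 := mul_le_mul_of_nonneg_left hcov (sub_nonneg.2 hab)
          have h2 := mul_le_mul_of_nonneg_left hkM hb0
          linarith
      _ = ∑ i, (((D i).card : ℝ) * (b - τ) - (b - a) * (cov (S i) (D i)).card - b * M) := by
          rw [Finset.sum_sub_distrib, Finset.sum_sub_distrib, ← Finset.sum_mul, ← Finset.mul_sum,
            hsum, Finset.sum_const, Finset.card_univ, Fintype.card_fin, nsmul_eq_mul]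
          ring
      _ ≤ _ := Finset.sum_le_sum fun i _ => hcluster i
  -- Cauchy–Schwarz over the clusters.
  have hcost0 : ∀ i, 0 ≤ cost i := fun i =>
    Finset.sum_nonneg fun _ _ => Finset.sum_nonneg fun _ _ => sq_nonneg _
  have hcs : (∑ i, √(cost i / (2 * (1 - η)))) ^ 2 ≤ I.k * ∑ i, cost i / (2 * (1 - η)) := by
    refine sq_sum_le_card_mul_sum_sq.trans_eq ?_
    rw [Finset.card_univ, Fintype.card_fin]
    congr 1
    exact Finset.sum_congr rfl fun i _ => Real.sq_sqrt (div_nonneg (hcost0 i) hη'.le)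
  have hN0 : 0 ≤ N := Nat.cast_nonneg _
  have hsq : (N * (α * a + (1 - α) * b - (τ + b * κ))) ^ 2 ≤
      (∑ i, √(cost i / (2 * (1 - η)))) ^ 2 :=
    pow_le_pow_left₀ (mul_nonneg hN0 (by linarith)) htotal 2
  rw [hCD, minSumCost_image hp hDE, card_eq_of_injOn hp hP, ← hN, div_le_iff₀ hk]
  have h4 := hsq.trans hcs
  rw [← Finset.sum_div, mul_div_assoc', le_div_iff₀ hη'] at h4
  calc _ = (N * (α * a + (1 - α) * b - (τ + b * κ))) ^ 2 * (2 * (1 - η)) := by ring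
    _ ≤ _ := h4
    _ = _ := mul_comm _ _

end clustering

/-! ### Distances between characteristic vectors and between points of the reduction -/

/-- The difference of the characteristic functions of two sets. -/
def indicatorDiff {n : ℕ} (T T' : Finset (Fin n)) (i : Fin n) : ℝ :=
  (if i ∈ T then 1 else 0) - (if i ∈ T' then 1 else 0)

section indicatorDiff

variable {n z : ℕ} {T T' : Finset (Fin n)}

theorem sum_indicatorDiff (hT : T.card = z) (hT' : T'.card = z) :
    ∑ i, indicatorDiff T T' i = 0 := by
  simp [indicatorDiff, Finset.sum_sub_distrib, hT, hT']

theorem sum_sq_indicatorDiff (hT : T.card = z) (hT' : T'.card = z) :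
    ∑ i, indicatorDiff T T' i ^ 2 = 2 * ((z : ℝ) - (T ∩ T').card) := by
  have h : ∀ i, indicatorDiff T T' i ^ 2 =
      (if i ∈ T then 1 else 0) + (if i ∈ T' then 1 else 0) - 2 * (if i ∈ T ∩ T' then 1 else 0) := by
    intro i
    by_cases h : i ∈ T <;> by_cases h' : i ∈ T' <;> norm_num [indicatorDiff, h, h']
  simp only [h, Finset.sum_sub_distrib, Finset.sum_add_distrib, ← Finset.mul_sum]
  simp only [Finset.sum_ite_mem, Finset.univ_inter, Finset.sum_const, nsmul_eq_mul, mul_one, hT,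
    hT']
  ring

theorem abs_indicatorDiff (i : Fin n) : |indicatorDiff T T' i| = indicatorDiff T T' i ^ 2 := by
  by_cases h : i ∈ T <;> by_cases h' : i ∈ T' <;> norm_num [indicatorDiff, h, h']

theorem mem_or_mem_of_indicatorDiff_ne_zero {i : Fin n} (h : indicatorDiff T T' i ≠ 0) :
    i ∈ T ∨ i ∈ T' := by
  by_contra hn
  rw [not_or] at hn
  simp [indicatorDiff, hn.1, hn.2] at h

theorem sum_indicatorDiff_mul (f : Fin n → ℝ) :
    ∑ i, indicatorDiff T T' i * f i = ∑ i ∈ T, f i - ∑ i ∈ T', f i := by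
  simp [indicatorDiff, sub_mul, Finset.sum_sub_distrib, Finset.sum_ite_mem]

end indicatorDiff

/-- The quadratic form of a Gram matrix with diagonal `g` and small entries off the diagonal. -/
theorem abs_sum_gram_sub_le {ι : Type*} [Fintype ι] {x : ι → ℝ} {G : ι → ι → ℝ} {g κ : ℝ}
    (hκ : 0 ≤ κ) (hdiag : ∀ i, x i ≠ 0 → G i i = g)
    (hoff : ∀ i j, x i ≠ 0 → x j ≠ 0 → i ≠ j → |G i j| ≤ κ) :
    |∑ i, ∑ j, x i * x j * G i j - g * ∑ i, x i ^ 2| ≤ κ * (∑ i, |x i|) ^ 2 := by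
  classical
  have h1 : g * ∑ i, x i ^ 2 = ∑ i, ∑ j, if i = j then x i * x j * g else 0 := by
    rw [Finset.mul_sum]
    refine Finset.sum_congr rfl fun i _ => ?_
    rw [Finset.sum_ite_eq, if_pos (Finset.mem_univ _)]
    ring
  rw [h1, ← Finset.sum_sub_distrib, sq, Finset.sum_mul_sum, Finset.mul_sum]
  refine (Finset.abs_sum_le_sum_abs _ _).trans (Finset.sum_le_sum fun i _ => ?_)
  rw [← Finset.sum_sub_distrib, Finset.mul_sum]
  refine (Finset.abs_sum_le_sum_abs _ _).trans (Finset.sum_le_sum fun j _ => ?_)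
  have h0 : 0 ≤ κ * (|x i| * |x j|) := by positivity
  by_cases hi : x i = 0
  · simp [hi]
  by_cases hj : x j = 0
  · simp [hj]
  by_cases hij : i = j
  · subst hij
    rw [if_pos rfl, hdiag i hi, sub_self, abs_zero]
    exact h0
  · rw [if_neg hij, sub_zero, abs_mul, abs_mul, mul_comm]
    exact mul_le_mul_of_nonneg_right (hoff i j hi hj hij) (by positivity)

/-- The increasing list of the members of a set. -/
def memberList {n : ℕ} (T : Finset (Fin n)) : List ℕ := (T.sort (· ≤ ·)).map fun i => i.val

theorem sum_map_memberList {n : ℕ} (T : Finset (Fin n)) (f : ℕ → ℕ) :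
    ((memberList T).map f).sum = ∑ i ∈ T, f i := by
  rw [memberList, List.map_map, ← List.sum_toFinset _ (Finset.sort_nodup _ _),
    Finset.sort_toFinset]
  rfl

namespace CoverageInstance

variable (I : CoverageInstance)

/-- The input of the reduction. -/
def toInput : ℕ × ℕ × List (List ℕ) := (I.n, I.k, I.sets.map memberList)

theorem encode_eq : I.encode = toData I.toInput := by
  simp only [encode, toInput, toData, List.map_map, Function.comp_def, memberList]

/-- The members of all sets, with repetitions. -/
def occurrences : List ℕ := (I.sets.map memberList).flatten

theorem mem_occurrences {T : Finset (Fin I.n)} (hT : T ∈ I.E) {i : Fin I.n} (hi : i ∈ T) :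
    i.val ∈ I.occurrences := by
  refine List.mem_flatten.2 ⟨memberList T, List.mem_map_of_mem (List.mem_toFinset.1 hT), ?_⟩
  exact List.mem_map_of_mem ((Finset.mem_sort _).2 hi)

theorem card_E : I.E.card = I.sets.length := List.toFinset_card_of_nodup I.nodup

theorem length_occurrences {z : ℕ} (h : ∀ T ∈ I.E, T.card = z) :
    I.occurrences.length = z * I.E.card := by
  rw [card_E, occurrences, List.length_flatten, List.map_map]
  have : ∀ T ∈ I.sets, (List.length ∘ memberList) T = z := by
    intro T hT
    simp [memberList, h T (List.mem_toFinset.2 hT)]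
  rw [List.map_congr_left this]
  simp [mul_comm]

/-- The point of the reduction that belongs to the set `T`, with rational coordinates. -/
def ratPoint (z A c : ℕ) (T : Finset (Fin I.n)) : Fin (dimension A I.occurrences).length → ℚ :=
  fun j => (pointOf z A c I.occurrences (memberList T)).getD j 0

/-- The point of the reduction that belongs to the set `T`. -/
noncomputable def point (z A c : ℕ) (T : Finset (Fin I.n)) :
    EuclideanSpace ℝ (Fin (dimension A I.occurrences).length) :=
  WithLp.toLp 2 fun j => (I.ratPoint z A c T j : ℝ)

variable {I} {z A c : ℕ}

theorem ofFn_ratPoint (T : Finset (Fin I.n)) :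
    List.ofFn (I.ratPoint z A c T) = pointOf z A c I.occurrences (memberList T) := by
  have hlen : (pointOf z A c I.occurrences (memberList T)).length =
      (dimension A I.occurrences).length := by
    rw [pointOf, List.length_map, length_sumWords]
  refine List.ext_getElem (by simp [hlen]) fun j h1 h2 => ?_
  rw [List.getElem_ofFn, ratPoint, List.getD_eq_getElem _ _ h2]

/-- The bits of the code word that belongs to `i`. -/
def wordBit (I : CoverageInstance) (A c : ℕ) (i : Fin I.n) (j : ℕ) : Bool :=
  (lookupWord (wordTable A c I.occurrences) i).getD j false

theorem ratPoint_apply {T : Finset (Fin I.n)} (hT : T.card = z)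
    (j : Fin (dimension A I.occurrences).length) : I.ratPoint z A c T j =
      (∑ i ∈ T, ((I.wordBit A c i j).toNat : ℚ)) / 2 ^ ((sideLog I.occurrences).length + A) := by
  have hj : j.val < (sumWords (dimension A I.occurrences) (wordTable A c I.occurrences)
      (memberList T)).length := by
    rw [length_sumWords]; exact j.2
  have h1 := getD_sumWords (dimension A I.occurrences) (wordTable A c I.occurrences)
    (memberList T) j.2
  rw [sum_map_memberList] at h1
  have h2 : ∑ i ∈ T, (I.wordBit A c i j).toNat ≤ z := by
    rw [← hT, Finset.card_eq_sum_ones]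
    exact Finset.sum_le_sum fun i _ => Bool.toNat_le _
  rw [ratPoint, pointOf, List.getD_eq_getElem _ _ (by simpa using hj), List.getElem_map,
    ← List.getD_eq_getElem _ [] hj, h1]
  change ((min (∑ i ∈ T, (I.wordBit A c i j).toNat) z : ℕ) : ℚ) / _ = _
  rw [min_eq_left h2]
  push_cast
  rfl

/-- The distances between the points of the reduction: the Gram matrix of the sign vectors of the
code words is close to a multiple of the identity matrix. -/
theorem abs_norm_point_sub_sq_sub_le (hc : 1 ≤ c) (hA : decayRate c ^ 4 ^ (A + 1) ≤ 1 / 2)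
    (hE : ∀ T ∈ I.E, T.card = z) {T T' : Finset (Fin I.n)} (hT : T ∈ I.E) (hT' : T' ∈ I.E) :
    |‖I.point z A c T - I.point z A c T'‖ ^ 2 - 2 * ((z : ℝ) - (T ∩ T').card)| ≤
      (2 * ((z : ℝ) - (T ∩ T').card)) ^ 2 / c := by
  obtain ⟨hlen, hcorr⟩ := lookupWord_wordTable hc hA I.occurrences
  set d := (dimension A I.occurrences).length with hd
  set e := (sideLog I.occurrences).length with he
  have hd4 : (d : ℝ) = 4 * (2 ^ (e + A)) ^ 2 := by
    rw [hd, length_dimension, ← he, ← pow_mul, mul_comm (e + A) 2, pow_mul]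
    push_cast
    ring
  have hd0 : (0 : ℝ) < d := by rw [hd4]; positivity
  have hc0 : (0 : ℝ) < c := by exact_mod_cast hc
  set x := indicatorDiff T T' with hx
  set G : Fin I.n → Fin I.n → ℝ := fun i i' =>
    ∑ j : Fin d, bitSign (I.wordBit A c i j) * bitSign (I.wordBit A c i' j) with hG
  have hocc : ∀ i, x i ≠ 0 → i.val ∈ I.occurrences := by
    intro i hi
    rcases mem_or_mem_of_indicatorDiff_ne_zero hi with h | h
    · exact I.mem_occurrences hT h
    · exact I.mem_occurrences hT' h
  have hGcorr : ∀ i i', x i ≠ 0 → x i' ≠ 0 → G i i' = correlation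
      (lookupWord (wordTable A c I.occurrences) i)
      (lookupWord (wordTable A c I.occurrences) i') := by
    intro i i' hi hi'
    have h1 := hlen _ (hocc i hi)
    have h2 := hlen _ (hocc i' hi')
    rw [correlation_eq_sum _ _ (h1.trans h2.symm)]
    simp only [hG, wordBit]
    rw [Fin.sum_univ_eq_sum_range (fun j =>
        bitSign ((lookupWord (wordTable A c I.occurrences) i).getD j false) *
        bitSign ((lookupWord (wordTable A c I.occurrences) i').getD j false)),
      Fin.sum_univ_eq_sum_range (fun j =>
        bitSign ((lookupWord (wordTable A c I.occurrences) i).getD j false) *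
        bitSign ((lookupWord (wordTable A c I.occurrences) i').getD j false)), h1]
  have hnorm : ‖I.point z A c T - I.point z A c T'‖ ^ 2 =
      (∑ i, ∑ i', x i * x i' * G i i') / d := by
    rw [EuclideanSpace.norm_sq_eq]
    have h1 : ∀ j : Fin d, (I.point z A c T - I.point z A c T') j =
        (∑ i, x i * bitSign (I.wordBit A c i j)) / (2 * 2 ^ (e + A)) := by
      intro j
      have h2 : (I.point z A c T - I.point z A c T') j =
          (I.ratPoint z A c T j : ℝ) - (I.ratPoint z A c T' j : ℝ) := rfl
      rw [h2, ratPoint_apply (hE T hT), ratPoint_apply (hE T' hT')]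
      push_cast
      rw [← he, ← sub_div, ← sum_indicatorDiff_mul, ← hx]
      have h3 : ∑ i, x i * bitSign (I.wordBit A c i j) =
          2 * ∑ i, x i * ((I.wordBit A c i j).toNat : ℝ) := by
        simp only [bitSign_eq, mul_sub, Finset.sum_sub_distrib, mul_one]
        rw [sum_indicatorDiff (hE T hT) (hE T' hT'), sub_zero, Finset.mul_sum]
        exact Finset.sum_congr rfl fun _ _ => by ring
      rw [h3, mul_div_mul_left _ _ two_ne_zero]
    have h4 : ∀ j : Fin d, ‖(I.point z A c T - I.point z A c T') j‖ ^ 2 =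
        (∑ i, ∑ i', x i * x i' *
          (bitSign (I.wordBit A c i j) * bitSign (I.wordBit A c i' j))) / d := by
      intro j
      rw [h1, Real.norm_eq_abs, sq_abs, div_pow, hd4, mul_pow, sq (∑ i, _), Finset.sum_mul_sum]
      congr 1
      · exact Finset.sum_congr rfl fun _ _ => Finset.sum_congr rfl fun _ _ => by ring
      · ring
    rw [Finset.sum_congr rfl fun j _ => h4 j, ← Finset.sum_div, Finset.sum_comm]
    congr 1
    refine Finset.sum_congr rfl fun i _ => ?_
    rw [Finset.sum_comm]
    exact Finset.sum_congr rfl fun i' _ => by rw [hG, Finset.mul_sum]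
  have hgram := abs_sum_gram_sub_le (x := x) (G := G) (g := d) (κ := d / c) (by positivity)
    (fun i hi => by rw [hGcorr i i hi hi, correlation_self, hlen _ (hocc i hi)])
    (fun i i' hi hi' hii' => by
      rw [hGcorr i i' hi hi', le_div_iff₀ hc0, mul_comm]
      exact hcorr _ (hocc i hi) _ (hocc i' hi') fun h => hii' (Fin.ext h))
  have habs : ∑ i, |x i| = 2 * ((z : ℝ) - (T ∩ T').card) := by
    rw [← sum_sq_indicatorDiff (hE T hT) (hE T' hT')]
    exact Finset.sum_congr rfl fun i _ => abs_indicatorDiff i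
  rw [habs, sum_sq_indicatorDiff (hE T hT) (hE T' hT')] at hgram
  set r := 2 * ((z : ℝ) - (T ∩ T').card)
  have h5 : ‖I.point z A c T - I.point z A c T'‖ ^ 2 - r =
      (∑ i, ∑ i', x i * x i' * G i i' - d * r) / d := by
    rw [hnorm]; field_simp
  rw [h5, abs_div, abs_of_pos hd0, div_le_iff₀ hd0]
  exact hgram.trans_eq (by ring)

theorem card_inter_le (hE : ∀ T ∈ I.E, T.card = z) {T T' : Finset (Fin I.n)} (hT : T ∈ I.E) :
    ((T ∩ T').card : ℝ) ≤ z := by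
  have h := Finset.card_le_card (Finset.inter_subset_left (s₁ := T) (s₂ := T'))
  rw [hE T hT] at h
  exact_mod_cast h

theorem norm_point_sub_sq_bounds {η : ℝ} (hc : 1 ≤ c) (hA : decayRate c ^ 4 ^ (A + 1) ≤ 1 / 2)
    (hcη : 2 * (z : ℝ) ≤ η * c) (hE : ∀ T ∈ I.E, T.card = z) {T T' : Finset (Fin I.n)}
    (hT : T ∈ I.E) (hT' : T' ∈ I.E) :
    (1 - η) * (2 * ((z : ℝ) - (T ∩ T').card)) ≤ ‖I.point z A c T - I.point z A c T'‖ ^ 2 ∧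
    ‖I.point z A c T - I.point z A c T'‖ ^ 2 ≤ (1 + η) * (2 * ((z : ℝ) - (T ∩ T').card)) := by
  have h1 := abs_norm_point_sub_sq_sub_le hc hA hE hT hT'
  have h2 := card_inter_le hE (T' := T') hT
  have hc0 : (0 : ℝ) < c := by exact_mod_cast hc
  have h3 : (2 * ((z : ℝ) - (T ∩ T').card)) ^ 2 / c ≤ η * (2 * ((z : ℝ) - (T ∩ T').card)) := by
    rw [div_le_iff₀ hc0, sq]
    have h4 : 2 * ((z : ℝ) - (T ∩ T').card) ≤ η * c := by
      have : (0 : ℝ) ≤ (T ∩ T').card := Nat.cast_nonneg _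
      linarith
    have h5 := mul_le_mul_of_nonneg_right h4 (show 0 ≤ 2 * ((z : ℝ) - (T ∩ T').card) by linarith)
    linarith
  have h6 := abs_le.1 (h1.trans h3)
  constructor <;> linarith

theorem injOn_of_norm_sub_sq {d : ℕ} {p : Finset (Fin I.n) → EuclideanSpace ℝ (Fin d)} {η : ℝ}
    (hη : η < 1) (hE : ∀ T ∈ I.E, T.card = z)
    (hlow : ∀ T ∈ I.E, ∀ T' ∈ I.E,
      (1 - η) * (2 * ((z : ℝ) - (T ∩ T').card)) ≤ ‖p T - p T'‖ ^ 2) : Set.InjOn p I.E := by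
  intro T hT T' hT' h
  have h1 := hlow T hT T' hT'
  rw [h, sub_self, norm_zero] at h1
  have h2 : (z : ℝ) ≤ (T ∩ T').card := by
    by_contra hlt
    have h3 : 0 < (1 - η) * (2 * ((z : ℝ) - (T ∩ T').card)) := by
      rw [not_le] at hlt
      exact mul_pos (by linarith) (by linarith)
    norm_num at h1
    linarith
  have h3 : z ≤ (T ∩ T').card := by exact_mod_cast h2
  have h4 : T ∩ T' = T := Finset.eq_of_subset_of_card_le Finset.inter_subset_left (by
    rw [hE T hT]; exact h3)
  have h5 : T ∩ T' = T' := Finset.eq_of_subset_of_card_le Finset.inter_subset_right (by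
    rw [hE T' hT']; exact h3)
  exact h4.symm.trans h5

/-- The characteristic vector of a set. -/
noncomputable def charPoint (T : Finset (Fin I.n)) : EuclideanSpace ℝ (Fin I.n) :=
  WithLp.toLp 2 fun i => if i ∈ T then (1 : ℝ) else 0

theorem norm_charPoint_sub_sq (hE : ∀ T ∈ I.E, T.card = z) {T T' : Finset (Fin I.n)}
    (hT : T ∈ I.E) (hT' : T' ∈ I.E) :
    ‖charPoint T - charPoint T'‖ ^ 2 = 2 * ((z : ℝ) - (T ∩ T').card) := by
  rw [EuclideanSpace.norm_sq_eq, ← sum_sq_indicatorDiff (hE T hT) (hE T' hT')]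
  refine Finset.sum_congr rfl fun i _ => ?_
  rw [Real.norm_eq_abs, sq_abs]
  rfl

theorem mem_charPoints (x : EuclideanSpace ℝ (Fin I.n)) :
    x ∈ I.charPoints ↔ ∃ T ∈ I.E, charPoint T = x := by
  simp [charPoints, charPoint]

variable (I z A c)

/-- The clustering instance that the reduction produces. -/
def toClustering (hinj : Set.InjOn (I.point z A c) I.E) : ClusteringInstance where
  d := (dimension A I.occurrences).length
  k := I.k
  points := I.sets.map (I.ratPoint z A c)
  nodup := I.nodup.map_on fun T hT T' hT' h =>
    hinj (List.mem_toFinset.2 hT) (List.mem_toFinset.2 hT') (by rw [point, point, h])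

variable {I z A c}

theorem encode_toClustering (hinj : Set.InjOn (I.point z A c) I.E) :
    (I.toClustering z A c hinj).encode = toData (reduction z A c I.toInput) := by
  simp only [ClusteringInstance.encode, toClustering, reduction, toInput, toData, List.map_map]
  congr 3
  funext T
  simp only [Function.comp_apply, ofFn_ratPoint]
  rfl

theorem mem_P_toClustering (hinj : Set.InjOn (I.point z A c) I.E)
    (x : EuclideanSpace ℝ (Fin (dimension A I.occurrences).length)) :
    x ∈ (I.toClustering z A c hinj).P ↔ ∃ T ∈ I.E, I.point z A c T = x := by
  refine List.mem_toFinset.trans ?_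
  simp only [toClustering, List.map_map, List.mem_map, E, List.mem_toFinset]
  rfl

/-- The factor in front of `log N` in the bound for the dimension. -/
noncomputable def dimensionFactor (z A : ℕ) : ℝ :=
  5 * 4 ^ (A + 1) * ((Real.log (4 * z + 2) / Real.log 2 + 1) / Real.log 2)

theorem isAdmissible_toClustering {y K : ℕ} (hdense : I.IsDense z y K) (hK : 2 ≤ K) (hy : 1 ≤ y)
    (hyz : y < z) (hinj : Set.InjOn (I.point z A c) I.E) :
    (I.toClustering z A c hinj).IsAdmissible (dimensionFactor z A) := by
  obtain ⟨hzn, hk, hEz, hE⟩ := hdense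
  have hcard : (I.toClustering z A c hinj).P.card = I.E.card :=
    card_eq_of_injOn hinj (mem_P_toClustering hinj)
  have hpow : 1 ≤ I.n ^ (z - y - 1) := Nat.one_le_pow _ _ (by omega)
  have h1 : 2 * I.k ≤ I.E.card := by
    refine le_trans ?_ hE
    calc 2 * I.k = 2 * (I.k * 1) := by ring
      _ ≤ _ := Nat.mul_le_mul hK (Nat.mul_le_mul le_rfl hpow)
  refine ⟨hk, ?_, ?_⟩
  · rw [hcard]
    change I.k ≤ _
    omega
  rw [hcard]
  change ((dimension A I.occurrences).length : ℝ) ≤ _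
  set N := I.E.card
  have hN : (2 : ℝ) ≤ N := by
    have : 2 ≤ N := by omega
    exact_mod_cast this
  set ℓ := (doubleLog I.occurrences).length
  have h2 : ((dimension A I.occurrences).length : ℝ) ≤ 5 * 4 ^ (A + 1) * ℓ := by
    exact_mod_cast dimension_le A I.occurrences
  have h3 : (2 : ℝ) ^ ℓ ≤ 4 * (z * N) + 2 := by
    have := two_pow_doubleLog_le I.occurrences
    rw [I.length_occurrences hEz] at this
    exact_mod_cast this
  have hlog2 : 0 < Real.log 2 := Real.log_pos (by norm_num)
  have hlogN : Real.log 2 ≤ Real.log N := Real.log_le_log (by norm_num) hN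
  have hz0 : (0 : ℝ) ≤ z := Nat.cast_nonneg _
  have hlogz : 0 ≤ Real.log (4 * z + 2) := Real.log_nonneg (by linarith)
  have h4 : ℓ * Real.log 2 ≤ Real.log (4 * z + 2) + Real.log N := by
    rw [← Real.log_pow, ← Real.log_mul (by positivity) (by positivity)]
    refine Real.log_le_log (by positivity) (h3.trans ?_)
    nlinarith
  have h5 : Real.log (4 * z + 2) ≤ Real.log (4 * z + 2) / Real.log 2 * Real.log N := by
    rw [div_mul_eq_mul_div, le_div_iff₀ hlog2]
    exact mul_le_mul_of_nonneg_left hlogN hlogz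
  refine h2.trans ?_
  rw [dimensionFactor, mul_assoc (5 * 4 ^ (A + 1) : ℝ)]
  refine mul_le_mul_of_nonneg_left ?_ (by positivity)
  rw [div_mul_eq_mul_div, le_div_iff₀ hlog2]
  linarith

end CoverageInstance

/-! ### The gap and the reduction -/

/-- The error terms of the lower bound are absorbed by the factor `1 - ε`. -/
theorem soundnessConstant_mul_le {α ε η : ℝ} {z y : ℕ} (hα : α ∈ Set.Icc (0 : ℝ) 1) (hyz : y < z)
    (hη : 0 < η) (hη' : η ≤ 1 / 8) (hε : 8 * η ≤ ε) :
    (1 - ε) * soundnessConstant α z y * (2 * (1 + η)) ≤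
      2 * (1 - η) * (α * √((z : ℝ) - y) + (1 - α) * √((z : ℝ) - y + 1) - η) ^ 2 ∧
    1 ≤ α * √((z : ℝ) - y) + (1 - α) * √((z : ℝ) - y + 1) := by
  have hu : (1 : ℝ) ≤ (z : ℝ) - y := by
    have : (y : ℝ) + 1 ≤ z := by exact_mod_cast hyz
    linarith
  have ha : 1 ≤ √((z : ℝ) - y) := Real.one_le_sqrt.2 hu
  have hb : 1 ≤ √((z : ℝ) - y + 1) := Real.one_le_sqrt.2 (by linarith)
  have hα0 := hα.1
  have hα1 : 0 ≤ 1 - α := sub_nonneg.2 hα.2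
  rw [soundnessConstant]
  set C := α * √((z : ℝ) - y) + (1 - α) * √((z : ℝ) - y + 1)
  have hC : 1 ≤ C := by
    have h1 := mul_le_mul_of_nonneg_left ha hα0
    have h2 := mul_le_mul_of_nonneg_left hb hα1
    linarith
  refine ⟨?_, hC⟩
  have h1 : C ^ 2 * (1 - 2 * η) ≤ (C - η) ^ 2 := by
    nlinarith [mul_nonneg hη.le (mul_nonneg (zero_le_one.trans hC) (sub_nonneg.2 hC)), sq_nonneg η]
  have h2 : (1 - ε) * (1 + η) ≤ (1 - η) * (1 - 2 * η) := by nlinarith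
  have h3 := mul_le_mul_of_nonneg_left h1 (show 0 ≤ 2 * (1 - η) by linarith)
  have h4 := mul_le_mul_of_nonneg_left h2 (show 0 ≤ 2 * C ^ 2 by positivity)
  linarith

theorem EveryCostAtLeast.mono {d k : ℕ} {P : Finset (EuclideanSpace ℝ (Fin d))} {a b : ℝ}
    (h : EveryCostAtLeast P k b) (hab : a ≤ b) : EveryCostAtLeast P k a := by
  intro C hC
  refine le_trans ?_ (h C hC)
  gcongr

/-- A reduction that is computed in polynomial time transfers hardness from one gap problem to
another. -/
theorem PromiseProblem.NPHard.of_reduction {Q R : PromiseProblem} {ι : Type*} {s t : ι → Data}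
    (hQ : Q.NPHard) (hst : Computes s t) {p : ι → Prop} {yes no : ι → Prop}
    (hyes : ∀ x ∈ Q.yes, ∃ i, x = s i ∧ p i ∧ yes i) (hno : ∀ x ∈ Q.no, ∃ i, x = s i ∧ p i ∧ no i)
    (hyes' : ∀ i, p i → yes i → t i ∈ R.yes) (hno' : ∀ i, p i → no i → t i ∈ R.no) :
    R.NPHard := by
  intro L hL
  obtain ⟨f, ⟨c, q, hf⟩, hfy, hfn⟩ := hQ L hL
  have h : ∀ x, ∃ i, f x = s i ∧ (x ∈ L → t i ∈ R.yes) ∧ (x ∉ L → t i ∈ R.no) := by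
    intro x
    by_cases hx : x ∈ L
    · obtain ⟨i, h1, h2, h3⟩ := hyes _ (hfy x hx)
      exact ⟨i, h1, fun _ => hyes' i h2 h3, fun h => absurd hx h⟩
    · obtain ⟨i, h1, h2, h3⟩ := hno _ (hfn x hx)
      exact ⟨i, h1, fun h => absurd h hx, fun _ => hno' i h2 h3⟩
  choose φ hφ hφy hφn using h
  have h1 : Computes (fun x : Data => x) (fun x => s (φ x)) :=
    Computes.congr (t := f) ⟨c, q, hf⟩ hφ
  exact ⟨fun x => t (φ x), h1.trans (hst.reindex φ), fun x hx => hφy x hx, fun x hx => hφn x hx⟩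

theorem mainTheorem2 (α δ : ℝ) (z y : ℕ) (hα : α ∈ Set.Icc (0 : ℝ) 1)
    (hδ : δ ∈ Set.Icc (0 : ℝ) 1) (hy : 1 ≤ y) (hyz : y < z)
    (hard : BalancedJohnsonCoverageStarNPHard α z y δ) (ε : ℝ) (hε : 0 < ε) :
    ∃ ρ : ℝ, 0 < ρ ∧
      (∃ D : ℝ, (minSumClusteringGap D ((1 + 3 * δ) * ((z : ℝ) - y) * ρ)
        ((1 - ε) * soundnessConstant α z y * ρ)).NPHard) ∧
      (∃ K : ℕ, ∀ I : CoverageInstance, I.IsDense z y K →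
        (I.Complete y δ → SomeCostAtMost I.charPoints I.k ((1 + 3 * δ) * ((z : ℝ) - y) * ρ)) ∧
        (I.Sound y α → EveryCostAtLeast I.charPoints I.k
          ((1 - ε) * soundnessConstant α z y * ρ))) := by
  -- The distortion of the distances, and the errors of the lower bound.
  obtain ⟨η, hη0, hη1, hηε⟩ : ∃ η : ℝ, 0 < η ∧ η ≤ 1 / 8 ∧ 8 * η ≤ ε :=
    ⟨min ε 1 / 8, by positivity, by linarith [min_le_right ε 1], by linarith [min_le_left ε 1]⟩
  set b := √((z : ℝ) - y + 1) with hb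
  have hu : (1 : ℝ) ≤ (z : ℝ) - y := by
    have : (y : ℝ) + 1 ≤ z := by exact_mod_cast hyz
    linarith
  have hb0 : 0 < b := Real.sqrt_pos.2 (by linarith)
  set τ := η / 2 with hτ
  set κ := η / (2 * b) with hκ
  have hκ0 : 0 < κ := by positivity
  have hτκ : τ + b * κ = η := by rw [hτ, hκ]; field_simp; norm_num
  obtain ⟨K, hK⟩ : ∃ K : ℕ, (z.choose y : ℝ) ^ 2 / τ ^ 4 ≤ κ * K := by
    obtain ⟨K, hK⟩ := exists_nat_ge ((z.choose y : ℝ) ^ 2 / τ ^ 4 / κ)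
    exact ⟨K, by rw [div_le_iff₀ hκ0] at hK; linarith⟩
  obtain ⟨hgap, hC⟩ := soundnessConstant_mul_le (ε := ε) (z := z) (y := y) hα hyz hη0 hη1 hηε
  -- The characteristic vectors and the points of the reduction satisfy the same bounds for the
  -- distances, hence the same bounds for the cost.
  have hcomplete : ∀ (I : CoverageInstance) (d : ℕ)
      (p : Finset (Fin I.n) → EuclideanSpace ℝ (Fin d)) (P : Finset (EuclideanSpace ℝ (Fin d))),
      Set.InjOn p I.E → (∀ x, x ∈ P ↔ ∃ T ∈ I.E, p T = x) →
      (∀ T ∈ I.E, ∀ T' ∈ I.E, ‖p T - p T'‖ ^ 2 ≤ (1 + η) * (2 * ((z : ℝ) - (T ∩ T').card))) →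
      I.Complete y δ → SomeCostAtMost P I.k ((1 + 3 * δ) * ((z : ℝ) - y) * (2 * (1 + η))) :=
    fun I d p P hp hP hup hI => hI.someCostAtMost hδ.1 hη0.le hyz.le hp hP hup
  have hsound : ∀ (I : CoverageInstance) (d K' : ℕ)
      (p : Finset (Fin I.n) → EuclideanSpace ℝ (Fin d)) (P : Finset (EuclideanSpace ℝ (Fin d))),
      K ≤ K' → I.IsDense z y K' →
      Set.InjOn p I.E → (∀ x, x ∈ P ↔ ∃ T ∈ I.E, p T = x) →
      (∀ T ∈ I.E, ∀ T' ∈ I.E, (1 - η) * (2 * ((z : ℝ) - (T ∩ T').card)) ≤ ‖p T - p T'‖ ^ 2) →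
      I.Sound y α →
      EveryCostAtLeast P I.k ((1 - ε) * soundnessConstant α z y * (2 * (1 + η))) := by
    intro I d K' p P hKK' hdense hp hP hlow hI
    have hK' : (z.choose y : ℝ) ^ 2 / τ ^ 4 ≤ κ * K' := by
      refine hK.trans (mul_le_mul_of_nonneg_left ?_ hκ0.le)
      exact_mod_cast hKK'
    have h := hI.everyCostAtLeast hdense hy hyz (by linarith) (by positivity) (by linarith) hK'
      (by rw [← hb, hτκ]; linarith) hp hP hlow
    rw [← hb, hτκ] at h
    exact h.mono hgap
  refine ⟨2 * (1 + η), by positivity, ?_, K, fun I hdense => ?_⟩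
  · obtain ⟨c, hc, hcη⟩ : ∃ c : ℕ, 1 ≤ c ∧ 2 * (z : ℝ) ≤ η * c := by
      obtain ⟨c, hc⟩ := exists_nat_ge (2 * (z : ℝ) / η)
      refine ⟨c + 1, by omega, ?_⟩
      rw [div_le_iff₀ hη0] at hc
      push_cast
      linarith
    obtain ⟨A₀, hA₀⟩ := exists_dimension_offset c
    set A := max A₀ z
    have hA := hA₀ A (le_max_left _ _)
    have hdist : ∀ I : CoverageInstance, I.IsDense z y (K + 2) → ∀ T ∈ I.E, ∀ T' ∈ I.E, _ :=
      fun I hI T hT T' hT' =>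
        CoverageInstance.norm_point_sub_sq_bounds (I := I) hc hA hcη hI.2.2.1 hT hT'
    have hinj : ∀ I : CoverageInstance, I.IsDense z y (K + 2) →
        Set.InjOn (I.point z A c) I.E := fun I hI =>
      CoverageInstance.injOn_of_norm_sub_sq (η := η) (by linarith) hI.2.2.1
        fun T hT T' hT' => (hdist I hI T hT T' hT').1
    -- `K + 2` instead of `K` ensures that there are at least two points, so that `log N > 0`.
    refine ⟨CoverageInstance.dimensionFactor z A, ?_⟩
    have hcomp : Computes (fun I : CoverageInstance => I.encode)
        (fun I => toData (reduction z A c I.toInput)) :=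
      ((Computes.refl _).congr fun I => I.encode_eq).trans
        (Computes.reindex (PolyTime.reduction (le_max_right A₀ z) c) CoverageInstance.toInput)
    refine (hard (K + 2)).of_reduction hcomp (p := fun I => I.IsDense z y (K + 2))
      (yes := fun I => I.Complete y δ) (no := fun I => I.Sound y α)
      (fun x hx => hx) (fun x hx => hx) (fun I hI hI' => ?_) (fun I hI hI' => ?_)
    · refine ⟨I.toClustering z A c (hinj I hI), (CoverageInstance.encode_toClustering _).symm,
        CoverageInstance.isAdmissible_toClustering hI (by omega) hy hyz _, ?_⟩
      exact hcomplete I _ (I.point z A c) _ (hinj I hI) (CoverageInstance.mem_P_toClustering _)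
        (fun T hT T' hT' => (hdist I hI T hT T' hT').2) hI'
    · refine ⟨I.toClustering z A c (hinj I hI), (CoverageInstance.encode_toClustering _).symm,
        CoverageInstance.isAdmissible_toClustering hI (by omega) hy hyz _, ?_⟩
      exact hsound I _ _ (I.point z A c) _ (by omega) hI (hinj I hI)
        (CoverageInstance.mem_P_toClustering _)
        (fun T hT T' hT' => (hdist I hI T hT T' hT').1) hI'
  · have hr : ∀ T ∈ I.E, ∀ T' ∈ I.E, (0 : ℝ) ≤ 2 * ((z : ℝ) - (T ∩ T').card) := by
      intro T hT T' _
      have := CoverageInstance.card_inter_le hdense.2.2.1 (T' := T') hT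
      linarith
    have hdist : ∀ T ∈ I.E, ∀ T' ∈ I.E,
        ‖CoverageInstance.charPoint T - CoverageInstance.charPoint T'‖ ^ 2 =
          2 * ((z : ℝ) - (T ∩ T').card) := fun T hT T' hT' =>
      CoverageInstance.norm_charPoint_sub_sq hdense.2.2.1 hT hT'
    have hlow : ∀ T ∈ I.E, ∀ T' ∈ I.E, (1 - η) * (2 * ((z : ℝ) - (T ∩ T').card)) ≤
        ‖CoverageInstance.charPoint T - CoverageInstance.charPoint T'‖ ^ 2 := by
      intro T hT T' hT'
      rw [hdist T hT T' hT']
      nlinarith [hr T hT T' hT']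
    have hinj := CoverageInstance.injOn_of_norm_sub_sq (by linarith) hdense.2.2.1 hlow
    refine ⟨hcomplete I _ _ _ hinj CoverageInstance.mem_charPoints fun T hT T' hT' => ?_,
      hsound I _ _ _ _ le_rfl hdense hinj CoverageInstance.mem_charPoints hlow⟩
    rw [hdist T hT T' hT']
    nlinarith [hr T hT T' hT']
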